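/- Let $\mathcal G$ be the dumbbell graph: two vertices, a loop $e_1$ at the first, a loop $e_2$ at the second, and an edge $e_3$ (the bridge) joining them. Replace each edge by two opposite directed edges $e,\bar e$, let $A(e,e')=1$ if $e'$ begins where $e$ ends and $e'\ne\bar e$, and $A(e,e')=0$ otherwise, and let $(\Sigma_A^+,\sigma)$ be the one-sided subshift of finite type of $A$. For $l:\{e_1,e_2,e_3\}\to\mathbb R_{>0}$ (with $l(\bar e)=l(e)$) let $$h(l)=\lim_{T\to\infty}\tfrac1T\log\#\{\gamma:\ l(\gamma)<T\},$$ where $\gamma=(\epsilon_0,\epsilon_1,\dots,\epsilon_n=\epsilon_0)$, $n\ge1$, runs over the closed cycles of directed edges with $A(\epsilon_i,\epsilon_{i+1})=1$ for $0\le i<n$, and $l(\gamma)=\sum_{i<n}l(\epsilon_i)$. Let $\mathcal M^1=\{l>0:\ h(l)=1\}\subset\mathbb R^3$. Regard functions $\phi$ of the edges as functions $\phi(\underline e)=\phi(e_0)$ on $\Sigma_A^+$. For $l\in\mathcal M^1$ let $m_{-l}$ be the equilibrium state of $-l$, i.e. $m_{-l}=v\mu/\int v\,d\mu$ with $v>0$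 continuous, $\mu$ a probability measure, $\mathcal L_{-l}v=v$, $\mathcal L_{-l}^*\mu=\mu$, where $(\mathcal L_{-l}w)(\underline x)=\sum_{\sigma\underline y=\underline x}e^{-l(\underline y)}w(\underline y)$. The pressure metric is $$\|\phi\|_P^2=\mathrm{Var}(\phi,m_{-l})=\lim_{n\to\infty}\frac1n\int\Big(\sum_{i<n}\phi\circ\sigma^i-n\int\phi\,dm_{-l}\Big)^2dm_{-l}$$ for $\phi$ tangent to $\mathcal M^1$ at $l$, and $d_P(l,l')$ is the infimum of $\int_0^1\|\dot\gamma\|_P\,dt$ over continuously differentiable curves $\gamma:[0,1]\to\mathcal M^1$ from $l$ to $l'$. Then: 1. $\mathcal M^1$ is the surface $\{(x,y,\log 2-\tfrac12\log((e^x-1)(e^y-1))):\ (x,y)\in U\}$, where $x=l(e_1)$, $y=l(e_2)$ and $U=\{x>0,\ y>0,\ (e^x-1)(e^y-1)<4\}$. For every $l\in\mathcal M^1$ the equilibrium state $m_{-l}$ exists and is unique, and the limit defining the variance exists for every function $\phi$ of the edges. 2. In the coordinates $(x,y)\in U$, $\|\cdot\|_P$ is a smooth Riemannian metric and it is diagonal: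 its first fundamental form has $F=0$ and $E,G>0$. 3. Its Gaussian curvature at $(x,y)\in U$ is $$K_P(x,y)=\frac{2e^{x+y}-1}{4e^{x+y}-3e^x-3e^y+2}.$$ 4. There is a constant $c_0>0$ with $K_P\ge c_0$ on $U$, but $K_P$ is not bounded above on $U$; in fact $K_P(x,y)\to\infty$ as $(x,y)\to(0,0)$ in $U$. 5. $(\mathcal M^1,d_P)$ is incomplete: there is a $d_P$-Cauchy sequence in $\mathcal M^1$ that does not $d_P$-converge to a point of $\mathcal M^1$. -/

import Mathlib

open Filter Topology MeasureTheory

noncomputable section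

/-- A finite undirected multigraph (loops and multiple edges allowed). Each edge carries an auxiliary
ordering of its two endpoints, used only to name its two directions. -/
structure FinGraph where
  numVertices : ℕ
  numEdges : ℕ
  ends : Fin numEdges → Fin numVertices × Fin numVertices

namespace FinGraph

variable (G : FinGraph)

/-- Edge functions; the edge weightings are the positive ones. -/
abbrev EdgeFun : Type := Fin G.numEdges → ℝ

/-- Directed edges: `(e, true)` is `e` in its chosen direction, `(e, false)` is its reversal. -/
abbrev DEdge : Type := Fin G.numEdges × Bool

/-- The same edge with the opposite direction. -/
def rev (e : G.DEdge) : G.DEdge := (e.1, !e.2)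

/-- Initial vertex of a directed edge. -/
def init (e : G.DEdge) : Fin G.numVertices := if e.2 then (G.ends e.1).1 else (G.ends e.1).2

/-- Terminal vertex of a directed edge. -/
def term (e : G.DEdge) : Fin G.numVertices := if e.2 then (G.ends e.1).2 else (G.ends e.1).1

/-- The relation `A(e, e') = 1`: the directed edge `e'` follows `e` and is not the reversal of `e`. -/
def Adj (e e' : G.DEdge) : Prop := G.term e = G.init e' ∧ e' ≠ G.rev e

/-- The closed cycles without backtracking `γ = (e₀, e₁, …, eₙ = e₀)`, `n ≥ 1`, of length
`l(e₀) + ⋯ + l(eₙ₋₁) < T`. -/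
def cyclesBelow (l : G.EdgeFun) (T : ℝ) : Set (Σ n : ℕ, Fin (n + 1) → G.DEdge) :=
  {γ | 1 ≤ γ.1 ∧ (∀ i : Fin γ.1, G.Adj (γ.2 i.castSucc) (γ.2 i.succ)) ∧
    γ.2 (Fin.last γ.1) = γ.2 0 ∧ ∑ i : Fin γ.1, l (γ.2 i.castSucc).1 < T}

/-- The metric graph `(G, l)` has entropy `h`: the limit of `(1/T) log #{γ : l(γ) < T}` exists
and equals `h`. -/
def HasEntropy (l : G.EdgeFun) (h : ℝ) : Prop :=
  Tendsto (fun T : ℝ => 1 / T * Real.log ((G.cyclesBelow l T).ncard : ℝ)) atTop (𝓝 h)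

/-- The moduli space of edge weightings with entropy one. -/
def moduliOne : Set G.EdgeFun := {l | (∀ e, 0 < l e) ∧ G.HasEntropy l 1}

/-- The one-sided subshift of finite type of `A`, with the product topology and Borel structure. -/
abbrev Path : Type := {x : ℕ → G.DEdge // ∀ n, G.Adj (x n) (x (n + 1))}

variable {G}

/-- The shift map. -/
def shift (x : G.Path) : G.Path := ⟨fun n => x.1 (n + 1), fun n => x.2 (n + 1)⟩

/-- The locally constant function on the shift space given by an edge function. -/
def onPath (φ : G.EdgeFun) (x : G.Path) : ℝ := φ (x.1 0).1

/-- The transfer operator `(L_f w)(x) = ∑_{σ y = x} e^{f(y)} w(y)` (a finite sum). -/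
def transfer (f w : G.Path → ℝ) (x : G.Path) : ℝ :=
  ∑ᶠ (y : G.Path) (_ : shift y = x), Real.exp (f y) * w y

/-- `m` is an equilibrium state of the pressure-zero function `f`: `m = v μ / ∫ v dμ`, where `v` is a
strictly positive continuous function with `L_f v = v` and `μ` is a Borel probability measure with
`L_f^* μ = μ`. (A strictly positive eigenfunction belongs to the spectral radius of `L_f`, so that
eigenvalue one says that the pressure of `f` is zero.) -/
def IsEquilibriumState (f : G.Path → ℝ) (m : Measure G.Path) : Prop :=
  ∃ (v : G.Path → ℝ) (μ : Measure G.Path),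
    Continuous v ∧ (∀ x, 0 < v x) ∧ (∀ x, transfer f v x = v x) ∧
    IsProbabilityMeasure μ ∧
    (∀ φ : G.Path → ℝ, Continuous φ → ∫ x, transfer f φ x ∂μ = ∫ x, φ x ∂μ) ∧
    m = (ENNReal.ofReal (∫ x, v x ∂μ))⁻¹ • μ.withDensity (fun x => ENNReal.ofReal (v x))

open Classical in
/-- The equilibrium state of `f` (zero if there is none). -/
def equilibriumState (f : G.Path → ℝ) : Measure G.Path :=
  if h : ∃ m, IsEquilibriumState f m then h.choose else 0

/-- The equilibrium state `m_{-l}` of an edge weighting. -/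
def eqState (l : G.EdgeFun) : Measure G.Path := equilibriumState (fun x => - onPath l x)

/-- `(1/n) ∫ (wⁿ - n ∫ w dμ)² dμ`, where `wⁿ` is the `n`-th Birkhoff sum of `w`. -/
def varianceSeq (w : G.Path → ℝ) (μ : Measure G.Path) (n : ℕ) : ℝ :=
  1 / (n : ℝ) * ∫ x, (birkhoffSum shift w n x - n * ∫ z, w z ∂μ) ^ 2 ∂μ

/-- The dynamical variance `Var(w, μ)`. -/
def dynVar (w : G.Path → ℝ) (μ : Measure G.Path) : ℝ := limUnder atTop (varianceSeq w μ)

/-- The square of the pressure norm, `‖φ‖_P² = Var(φ, m_{-l})`. -/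
def pressureSq (l φ : G.EdgeFun) : ℝ := dynVar (onPath φ) (eqState l)

/-- The bilinear form of the pressure metric, obtained by polarization. -/
def pressureInner (l φ ψ : G.EdgeFun) : ℝ :=
  1 / 2 * (pressureSq l (φ + ψ) - pressureSq l φ - pressureSq l ψ)

/-- The pressure length of a curve defined on `[0, 1]`. -/
def pressureLength (γ : ℝ → G.EdgeFun) : ENNReal :=
  ∫⁻ t in Set.Icc (0 : ℝ) 1,
    ENNReal.ofReal (Real.sqrt (pressureSq (γ t) (derivWithin γ (Set.Icc 0 1) t)))

/-- The path distance of the pressure metric: the infimum of the lengths of the continuously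
differentiable curves `[0, 1] → M¹` from `l₁` to `l₂`. -/
def pressureDist (l₁ l₂ : G.EdgeFun) : ENNReal :=
  ⨅ (γ : ℝ → G.EdgeFun) (_ : ContDiffOn ℝ 1 γ (Set.Icc 0 1) ∧
    (∀ t ∈ Set.Icc (0 : ℝ) 1, γ t ∈ G.moduliOne) ∧ γ 0 = l₁ ∧ γ 1 = l₂), pressureLength γ

variable (G) in
/-- The space `M¹` is complete for the path distance of the pressure metric: every Cauchy sequence
in it converges to a point of it. -/
def PressureComplete : Prop :=
  ∀ u : ℕ → G.EdgeFun, (∀ n, u n ∈ G.moduliOne) →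
    (∀ ε : ENNReal, 0 < ε → ∃ N, ∀ m ≥ N, ∀ n ≥ N, pressureDist (u m) (u n) < ε) →
    ∃ l ∈ G.moduliOne, Tendsto (fun n => pressureDist (u n) l) atTop (𝓝 0)

end FinGraph

/-- The `i`-th partial derivative of a function of two real variables. -/
def partialD {F : Type*} [NormedAddCommGroup F] [NormedSpace ℝ F] (i : Fin 2)
    (f : (Fin 2 → ℝ) → F) (p : Fin 2 → ℝ) : F :=
  lineDeriv ℝ f p (Pi.single i 1)

/-- The Christoffel symbol `Γᵏᵢⱼ` of a metric `g` in two coordinates. -/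
def christoffel (g : (Fin 2 → ℝ) → Matrix (Fin 2) (Fin 2) ℝ) (k i j : Fin 2) (p : Fin 2 → ℝ) : ℝ :=
  1 / 2 * ∑ m, (g p)⁻¹ k m *
    (partialD i (fun q => g q j m) p + partialD j (fun q => g q i m) p
      - partialD m (fun q => g q i j) p)

/-- The `m`-th component of `R(∂ᵢ, ∂ⱼ)∂ₖ`. -/
def curvatureTensor (g : (Fin 2 → ℝ) → Matrix (Fin 2) (Fin 2) ℝ) (m k i j : Fin 2)
    (p : Fin 2 → ℝ) : ℝ :=
  partialD i (christoffel g m j k) p - partialD j (christoffel g m i k) p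
    + ∑ s, (christoffel g s j k p * christoffel g m i s p
      - christoffel g s i k p * christoffel g m j s p)

/-- The Gaussian curvature `g(R(∂₁, ∂₂)∂₂, ∂₁) / det g` of a metric in two coordinates. -/
def gaussCurvature (g : (Fin 2 → ℝ) → Matrix (Fin 2) (Fin 2) ℝ) (p : Fin 2 → ℝ) : ℝ :=
  (∑ m, g p 0 m * curvatureTensor g m 1 0 1 p) / (g p).det

/-- The first fundamental form of the pressure metric along a parametrized surface `Φ`. -/
def pressureForm {G : FinGraph} (Φ : (Fin 2 → ℝ) → G.EdgeFun) (p : Fin 2 → ℝ) :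
    Matrix (Fin 2) (Fin 2) ℝ :=
  Matrix.of fun i j => FinGraph.pressureInner (Φ p) (partialD i Φ p) (partialD j Φ p)

/-- The dumbbell: two vertices, a loop at each of them (edges `0` and `1`), and a bridge (edge `2`). -/
def dumbbell : FinGraph where
  numVertices := 2
  numEdges := 3
  ends := ![(0, 0), (1, 1), (0, 1)]

/-- The coordinate domain `x, y > 0`, `(eˣ - 1)(eʸ - 1) < 4`. -/
def dumbbellDomain : Set (Fin 2 → ℝ) :=
  {p | 0 < p 0 ∧ 0 < p 1 ∧ (Real.exp (p 0) - 1) * (Real.exp (p 1) - 1) < 4}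

/-- The map `(x, y) ↦ (x, y, log 2 - (1/2) log ((eˣ - 1)(eʸ - 1)))`. -/
def dumbbellChart (p : Fin 2 → ℝ) : dumbbell.EdgeFun :=
  ![p 0, p 1,
    Real.log 2 - 1 / 2 * Real.log ((Real.exp (p 0) - 1) * (Real.exp (p 1) - 1))]

/-- The first fundamental form of the pressure metric of the dumbbell in the coordinates `(x, y)`. -/
def dumbbellForm : (Fin 2 → ℝ) → Matrix (Fin 2) (Fin 2) ℝ := pressureForm dumbbellChart

end

/-!
A weighting `l` has entropy one exactly when the matrix `A(e, e') e^{-l(e)}` has a positive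
eigenvector of eigenvalue one, for then the number of closed paths of length less than `T` grows
like `e^T`; for the dumbbell this is the equation `(eˣ - 1)(eʸ - 1)e^{2z} = 4`. The eigenvector
normalizes the transfer operator to a Markov operator, so that the equilibrium state is a stationary
Markov chain (run backwards), and solving Poisson's equation for an edge function writes its
Birkhoff sums as sums of orthogonal increments up to a bounded error; the variance is the second
moment of one increment.

In terms of `s = 1 / (eˣ - 1)` and `t = 1 / (eʸ - 1)` the metric is
`(s(1 + s) dx² + t(1 + t) dy²) / (4 + s + t)`, whence the curvature. Shrinking one loop to a point
takes only finite length, but the mass `1 / (4 + s + t)` of the bridge is Lipschitz for the pressure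
metric, positive on the surface, and tends to zero along such a curve, which therefore has no limit.
-/

noncomputable section

/-! ### Invariant probability measures of Markov operators -/

theorem norm_iterate_apply_le {X : Type*} [TopologicalSpace X] [CompactSpace X]
    {A : C(X, ℝ) →ₚ[ℝ] C(X, ℝ)} (hA : A 1 = 1) (f : C(X, ℝ)) (n : ℕ) (x : X) :
    ‖(A^[n] f) x‖ ≤ ‖f‖ := by
  have hfix (c : ℝ) : A^[n] (c • 1) = c • 1 :=
    Function.iterate_fixed (by rw [map_smul, hA]) n
  have hmono : Monotone (A^[n]) := (OrderHomClass.mono A).iterate n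
  have hle : f ≤ ‖f‖ • 1 := fun y => by simpa using (le_abs_self _).trans (f.norm_coe_le_norm y)
  have hge : (-‖f‖) • 1 ≤ f := fun y => by
    simpa using neg_le.1 ((neg_le_abs _).trans (f.norm_coe_le_norm y))
  refine abs_le.2 ⟨?_, ?_⟩
  · simpa [hfix] using hmono hge x
  · simpa [hfix] using hmono hle x

section InvariantMeasure

variable {X : Type*} [TopologicalSpace X] [T2Space X] [CompactSpace X] [MeasurableSpace X]
  [BorelSpace X]

theorem exists_isProbabilityMeasure_integral_eq (Λ : C(X, ℝ) →ₚ[ℝ] ℝ) (hΛ : Λ 1 = 1) :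
    ∃ μ : Measure X, IsProbabilityMeasure μ ∧ ∀ f : C(X, ℝ), ∫ x, f x ∂μ = Λ f := by
  let Λ' : CompactlySupportedContinuousMap X ℝ →ₚ[ℝ] ℝ := .mk₀
    { toFun := fun f => Λ f.toContinuousMap
      map_add' := fun f g => map_add Λ _ _
      map_smul' := fun c f => map_smul Λ c _ }
    fun f hf => map_nonneg Λ (a := f.toContinuousMap) hf
  have hint (f : C(X, ℝ)) : ∫ x, f x ∂(RealRMK.rieszMeasure Λ') = Λ f :=
    RealRMK.integral_rieszMeasure Λ' ⟨f, HasCompactSupport.of_compactSpace f⟩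
  refine ⟨RealRMK.rieszMeasure Λ', ⟨?_⟩, hint⟩
  simpa [hΛ, Measure.real, ENNReal.toReal_eq_one_iff] using hint 1

/-- Krylov–Bogoliubov: a weak limit of the measures representing `f ↦ n⁻¹ ∑ k < n, Aᵏ f x₀` is
invariant. -/
theorem exists_isProbabilityMeasure_integral_map_eq [Nonempty X] {A : C(X, ℝ) →ₚ[ℝ] C(X, ℝ)}
    (hA : A 1 = 1) :
    ∃ μ : Measure X, IsProbabilityMeasure μ ∧ ∀ f, ∫ x, A f x ∂μ = ∫ x, f x ∂μ := by
  obtain ⟨x₀⟩ := ‹Nonempty X›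
  let avg (n : ℕ) (f : C(X, ℝ)) : ℝ := birkhoffAverage ℝ A (fun g => g x₀) n f
  have hiter (k : ℕ) (f : C(X, ℝ)) : A^[k] f = (A.toLinearMap ^ k) f :=
    (congrFun (Module.End.coe_pow A.toLinearMap k) f).symm
  have hmean (n : ℕ) : ∃ μ : Measure X, IsProbabilityMeasure μ ∧
      ∀ f : C(X, ℝ), ∫ x, f x ∂μ = avg (n + 1) f := by
    refine exists_isProbabilityMeasure_integral_eq (.mk₀
      { toFun := avg (n + 1), map_add' := fun f g => ?_, map_smul' := fun c f => ?_ }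
      fun f hf => ?_) ?_
    · simp [avg, birkhoffAverage, birkhoffSum, hiter, Finset.sum_add_distrib, mul_add]
    · simp [avg, birkhoffAverage, birkhoffSum, hiter, ← Finset.mul_sum, mul_left_comm]
    · have hnonneg (k : ℕ) : 0 ≤ A^[k] f := by
        induction k with
        | zero => exact hf
        | succ k ih => rw [Function.iterate_succ_apply']; exact map_nonneg A ih
      exact smul_nonneg (by positivity) (Finset.sum_nonneg fun k _ => hnonneg k x₀)
    · exact Function.IsFixedPt.birkhoffAverage_eq (R := ℝ) hA _ (Nat.cast_ne_zero.2 n.succ_ne_zero)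
  choose ν hν hνavg using hmean
  let F : Ultrafilter ℕ := hyperfilter ℕ
  obtain ⟨μ, -, hμ⟩ := (isCompact_univ (X := ProbabilityMeasure X)).ultrafilter_le_nhds
    (F.map fun n => ⟨ν n, hν n⟩) (by simp)
  have hlim (f : C(X, ℝ)) : Tendsto (fun n => avg (n + 1) f) F (𝓝 (∫ x, f x ∂μ)) := by
    simpa only [← hνavg] using! ProbabilityMeasure.tendsto_iff_forall_integral_tendsto.1 hμ
      (BoundedContinuousFunction.mkOfCompact f)
  refine ⟨μ, inferInstance, fun f => sub_eq_zero.1 ?_⟩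
  have hbounded : Bornology.IsBounded (Set.range fun n => (A^[n] f) x₀) :=
    isBounded_iff_forall_norm_le.2
      ⟨‖f‖, by rintro _ ⟨n, rfl⟩; exact norm_iterate_apply_le hA f n x₀⟩
  exact tendsto_nhds_unique ((hlim (A f)).sub (hlim f))
    (((tendsto_birkhoffAverage_apply_sub_birkhoffAverage ℝ hbounded).comp
      (tendsto_add_atTop_nat 1)).mono_left Nat.hyperfilter_le_atTop)

end InvariantMeasure

/-! ### The path space and its transfer operator -/

theorem eq_of_forall_le_of_sum_mul_eq {ι : Type*} [Fintype ι] {q a : ι → ℝ} {c : ℝ}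
    (hq : ∀ i, 0 ≤ q i) (hq1 : ∑ i, q i = 1) (hca : ∀ i, c ≤ a i) (hqa : ∑ i, q i * a i = c)
    {i : ι} (hi : 0 < q i) : a i = c := by
  have hzero : ∑ i, q i * (a i - c) = 0 := by
    simp only [mul_sub, Finset.sum_sub_distrib, ← Finset.sum_mul, hq1, hqa, one_mul, sub_self]
  have hterm := (Finset.sum_eq_zero_iff_of_nonneg
    (fun i _ => mul_nonneg (hq i) (sub_nonneg.2 (hca i)))).1 hzero i (Finset.mem_univ i)
  exact sub_eq_zero.1 ((mul_eq_zero.1 hterm).resolve_left hi.ne')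

/-- Simplicity of the Perron eigenvalue: at an index where `r / u` is minimal, the ratio is a
weighted average of its values at the successors of that index. -/
theorem exists_eq_mul_of_irreducible {ι : Type*} [Fintype ι] {M : ι → ι → ℝ} {u r : ι → ℝ}
    (hM : ∀ i j, 0 ≤ M i j) (hirr : ∀ i j, Relation.ReflTransGen (fun i j => 0 < M i j) i j)
    (hu : ∀ i, 0 < u i) (hMu : ∀ i, ∑ j, M i j * u j = u i) (hMr : ∀ i, ∑ j, M i j * r j = r i) :
    ∃ c, ∀ i, r i = c * u i := by
  rcases isEmpty_or_nonempty ι with _ | _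
  · exact ⟨0, fun i => isEmptyElim i⟩
  obtain ⟨i₀, hmin⟩ := Finite.exists_min fun i => r i / u i
  refine ⟨r i₀ / u i₀, fun i => (div_eq_iff (hu i).ne').1 ?_⟩
  induction hirr i₀ i with
  | refl => rfl
  | @tail i j _ hij ih =>
    have hsum : ∑ k, M i k * u k / u i = 1 := by
      rw [← Finset.sum_div, hMu, div_self (hu i).ne']
    have hratio : ∑ k, M i k * u k / u i * (r k / u k) = r i / u i := by
      rw [← hMr i, Finset.sum_div]
      refine Finset.sum_congr rfl fun k _ => ?_
      have := (hu k).ne'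
      field_simp
    rw [← ih]
    exact eq_of_forall_le_of_sum_mul_eq (a := fun k => r k / u k)
      (fun k => div_nonneg (mul_nonneg (hM i k) (hu k).le) (hu i).le) hsum
      (fun k => ih.trans_le (hmin k)) hratio (div_pos (mul_pos hij (hu j)) (hu i))

theorem inv_smul_withDensity_eq_tilted {Ω : Type*} [MeasurableSpace Ω] {μ : Measure Ω}
    {v : Ω → ℝ} (hv : ∀ x, 0 < v x) (hint : 0 < ∫ x, v x ∂μ) :
    (ENNReal.ofReal (∫ x, v x ∂μ))⁻¹ • μ.withDensity (fun x => ENNReal.ofReal (v x)) =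
      μ.tilted fun x => Real.log (v x) := by
  have hne : (ENNReal.ofReal (∫ x, v x ∂μ))⁻¹ ≠ ⊤ :=
    ENNReal.inv_ne_top.2 (ENNReal.ofReal_pos.2 hint).ne'
  rw [← withDensity_smul' _ _ hne]
  simp only [Measure.tilted, Real.exp_log (hv _), ENNReal.ofReal_div_of_pos hint,
    ENNReal.div_eq_inv_mul]
  rfl

namespace FinGraph

variable {G : FinGraph}

instance decidableAdj : DecidableRel G.Adj := fun e e' =>
  inferInstanceAs (Decidable (G.term e = G.init e' ∧ e' ≠ G.rev e))

section PathSpace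

/-- Prepend a directed edge to a path that it can precede; a path that it cannot precede is left
unchanged. -/
def cons (e : G.DEdge) (x : G.Path) : G.Path :=
  if h : G.Adj e (x.1 0) then ⟨fun n => Nat.casesOn n e x.1, Nat.rec h fun n _ => x.2 n⟩ else x

theorem cons_zero {e : G.DEdge} {x : G.Path} (h : G.Adj e (x.1 0)) : (cons e x).1 0 = e := by
  simp [cons, h]

theorem cons_succ {e : G.DEdge} {x : G.Path} (h : G.Adj e (x.1 0)) (n : ℕ) :
    (cons e x).1 (n + 1) = x.1 n := by
  simp [cons, h]

theorem shift_cons {e : G.DEdge} {x : G.Path} (h : G.Adj e (x.1 0)) : shift (cons e x) = x :=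
  Subtype.ext (funext fun n => cons_succ h n)

theorem cons_head_shift (x : G.Path) : cons (x.1 0) (shift x) = x := by
  have h : G.Adj (x.1 0) ((shift x).1 0) := x.2 0
  refine Subtype.ext (funext fun n => ?_)
  cases n with
  | zero => exact cons_zero h
  | succ n => exact cons_succ h n

theorem setOf_shift_eq (x : G.Path) :
    {y : G.Path | shift y = x} = (fun e => cons e x) '' {e | G.Adj e (x.1 0)} := by
  ext y
  constructor
  · rintro rfl
    exact ⟨y.1 0, y.2 0, cons_head_shift y⟩
  · rintro ⟨e, h, rfl⟩
    exact shift_cons h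

instance compactSpace_path : CompactSpace G.Path := by
  refine isCompact_iff_compactSpace.1 (IsClosed.isCompact ?_)
  change IsClosed {x : ℕ → G.DEdge | ∀ n, G.Adj (x n) (x (n + 1))}
  have hclosed (n : ℕ) : IsClosed {x : ℕ → G.DEdge | G.Adj (x n) (x (n + 1))} :=
    (isClosed_discrete {p : G.DEdge × G.DEdge | G.Adj p.1 p.2}).preimage
      (f := fun x : ℕ → G.DEdge => (x n, x (n + 1))) (by fun_prop)
  simpa only [Set.ofPred_forall] using isClosed_iInter hclosed

theorem continuous_coord (n : ℕ) : Continuous fun x : G.Path => x.1 n :=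
  (continuous_apply n).comp continuous_subtype_val

theorem continuous_comp_coord {α : Type*} [TopologicalSpace α] (F : G.DEdge → α) (n : ℕ) :
    Continuous fun x : G.Path => F (x.1 n) :=
  continuous_of_discreteTopology.comp (continuous_coord n)

theorem continuous_shift : Continuous (shift : G.Path → G.Path) :=
  Continuous.subtype_mk (continuous_pi fun n => continuous_coord (n + 1)) _

theorem continuous_cons (e : G.DEdge) : Continuous (cons e) := by
  refine Continuous.subtype_mk (f := fun x => (cons e x).1) (continuous_pi fun n => ?_) _
  have hcoord : (fun x : G.Path => (cons e x).1 n) =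
      (fun p : G.DEdge × G.DEdge × G.DEdge => if G.Adj e p.1 then
        (Nat.casesOn n e fun _ => p.2.1 : G.DEdge) else p.2.2) ∘
      fun x => (x.1 0, x.1 (n - 1), x.1 n) := by
    funext x
    by_cases hx : G.Adj e (x.1 0)
    · cases n <;> simp [cons, hx]
    · simp [cons, hx]
  rw [hcoord]
  exact continuous_of_discreteTopology.comp ((continuous_coord 0).prodMk
    ((continuous_coord (n - 1)).prodMk (continuous_coord n)))

theorem integrable_of_continuous {φ : G.Path → ℝ} (hφ : Continuous φ) (m : Measure G.Path)
    [IsFiniteMeasure m] : Integrable φ m :=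
  hφ.integrable_of_hasCompactSupport (HasCompactSupport.of_compactSpace φ)

/-- The paths whose first `n` edges are those of the sequence `y`. -/
def cyl (n : ℕ) (y : ℕ → G.DEdge) : Set G.Path := Subtype.val ⁻¹' PiNat.cylinder y n

theorem mem_cyl_succ {n : ℕ} {y : ℕ → G.DEdge} {x : G.Path} :
    x ∈ cyl (n + 1) y ↔ x.1 0 = y 0 ∧ ∀ i < n, x.1 (i + 1) = y (i + 1) :=
  Nat.forall_lt_succ_left'

theorem isTopologicalBasis_cyl :
    TopologicalSpace.IsTopologicalBasis {s : Set G.Path | ∃ y n, cyl n y = s} := by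
  convert! (PiNat.isTopologicalBasis_cylinders fun _ => G.DEdge).isInducing .subtypeVal using 1
  ext s
  constructor
  · rintro ⟨y, n, rfl⟩
    exact ⟨_, ⟨y, n, rfl⟩, rfl⟩
  · rintro ⟨_, ⟨y, n, rfl⟩, rfl⟩
    exact ⟨y, n, rfl⟩

theorem isClopen_cyl (n : ℕ) (y : ℕ → G.DEdge) : IsClopen (cyl n y) := by
  have : cyl n y = ⋂ i ∈ Finset.range n, (fun x : G.Path => x.1 i) ⁻¹' {y i} := by
    ext x; simp [cyl]
  rw [this]
  exact isClopen_biInter_finset fun i _ => (isClopen_discrete _).preimage (continuous_coord i)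

theorem isPiSystem_cyl : IsPiSystem {s : Set G.Path | ∃ y n, cyl n y = s} := by
  have hnested {n m : ℕ} (y z : ℕ → G.DEdge) (hnm : n ≤ m) (h : (cyl n y ∩ cyl m z).Nonempty) :
      cyl n y ∩ cyl m z = cyl m z := by
    obtain ⟨x, hy, hz⟩ := h
    refine Set.inter_eq_right.2 fun w hw i hi => ?_
    rw [hw i (hi.trans_le hnm), ← hy i hi, hz i (hi.trans_le hnm)]
  rintro _ ⟨y, n, rfl⟩ _ ⟨z, m, rfl⟩ h
  rcases le_total n m with hnm | hmn
  · exact ⟨z, m, (hnested y z hnm h).symm⟩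
  · rw [Set.inter_comm] at h ⊢
    exact ⟨y, n, (hnested z y hmn h).symm⟩

theorem measure_ext_of_cyl {μ ν : Measure G.Path} [IsProbabilityMeasure μ] [IsProbabilityMeasure ν]
    (h : ∀ n y, μ.real (cyl n y) = ν.real (cyl n y)) : μ = ν := by
  have : SecondCountableTopology G.Path := TopologicalSpace.Subtype.secondCountableTopology _
  refine ext_of_generate_finite _ ?_ isPiSystem_cyl ?_ (by simp)
  · rw [← isTopologicalBasis_cyl.borel_eq_generateFrom]
    exact BorelSpace.measurable_eq
  · rintro _ ⟨y, n, rfl⟩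
    exact (measureReal_eq_measureReal_iff).1 (h n y)

end PathSpace

/-- Any two directed edges are joined by a path without backtracking. -/
def Irreducible (G : FinGraph) : Prop := ∀ e e' : G.DEdge, Relation.ReflTransGen G.Adj e e'

theorem Irreducible.dense_of_cons_mem (hG : G.Irreducible) {S : Set G.Path} (hS : S.Nonempty)
    (hcons : ∀ x ∈ S, ∀ e, G.Adj e (x.1 0) → cons e x ∈ S) : Dense S := by
  have hhead (e : G.DEdge) : ∃ x ∈ S, x.1 0 = e := by
    obtain ⟨x₀, hx₀⟩ := hS
    induction hG e (x₀.1 0) using Relation.ReflTransGen.head_induction_on with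
    | refl => exact ⟨x₀, hx₀, rfl⟩
    | head hadj _ ih =>
      obtain ⟨x, hx, rfl⟩ := ih
      exact ⟨cons _ x, hcons x hx _ hadj, cons_zero hadj⟩
  have hword (n : ℕ) (y : G.Path) : ∃ x ∈ S, x.1 0 = y.1 0 ∧ x ∈ cyl n y.1 := by
    induction n generalizing y with
    | zero =>
      obtain ⟨x, hx, hxy⟩ := hhead (y.1 0)
      exact ⟨x, hx, hxy, by simp [cyl]⟩
    | succ n ih =>
      obtain ⟨x, hx, hhd, hxy⟩ := ih (shift y)
      have hadj : G.Adj (y.1 0) (x.1 0) := hhd ▸ y.2 0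
      refine ⟨cons (y.1 0) x, hcons x hx _ hadj, cons_zero hadj, mem_cyl_succ.2
        ⟨cons_zero hadj, fun i hi => ?_⟩⟩
      rw [cons_succ hadj]
      exact hxy i hi
  refine isTopologicalBasis_cyl.dense_iff.2 ?_
  rintro _ ⟨y, n, rfl⟩ ⟨z, hz⟩
  obtain ⟨x, hx, -, hxz⟩ := hword n z
  exact ⟨x, fun i hi => (hxz i hi).trans (hz i hi), hx⟩

end FinGraph

/-! ### Equilibrium states of Perron data -/

theorem integral_tilted_log {Ω : Type*} [MeasurableSpace Ω] {μ : Measure Ω} {v : Ω → ℝ}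
    (hv : ∀ x, 0 < v x) (φ : Ω → ℝ) :
    ∫ x, φ x ∂μ.tilted (fun x => Real.log (v x)) = (∫ x, v x ∂μ)⁻¹ * ∫ x, φ x * v x ∂μ := by
  simp only [integral_tilted, Real.exp_log (hv _), smul_eq_mul, ← integral_const_mul]
  exact integral_congr_ae (.of_forall fun x => by ring)

namespace FinGraph

variable {G : FinGraph}

section Transfer

variable {l : G.EdgeFun}

/-- The adjacency matrix `A` with its rows weighted by `e^{-l}`. -/
def weight (l : G.EdgeFun) (e e' : G.DEdge) : ℝ := if G.Adj e e' then Real.exp (-l e.1) else 0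

theorem weight_nonneg (l : G.EdgeFun) (e e' : G.DEdge) : 0 ≤ weight l e e' := by
  unfold weight; split_ifs <;> positivity

theorem weight_of_adj {e e' : G.DEdge} (h : G.Adj e e') : weight l e e' = Real.exp (-l e.1) :=
  if_pos h

theorem weight_of_not_adj {e e' : G.DEdge} (h : ¬ G.Adj e e') : weight l e e' = 0 := if_neg h

theorem weight_pos {e e' : G.DEdge} (h : G.Adj e e') : 0 < weight l e e' := by
  rw [weight_of_adj h]; exact Real.exp_pos _

theorem transfer_eq_sum (w : G.Path → ℝ) (x : G.Path) :
    transfer (fun y => -onPath l y) w x = ∑ e, weight l e (x.1 0) * w (cons e x) := by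
  have hinj : Set.InjOn (fun e => cons e x) {e | G.Adj e (x.1 0)} := fun e he e' he' h => by
    rw [← cons_zero he, ← cons_zero he']
    exact congrArg (fun y : G.Path => y.1 0) h
  rw [transfer, show (∑ᶠ (y : G.Path) (_ : shift y = x), Real.exp (-onPath l y) * w y) =
      ∑ᶠ y ∈ {y | shift y = x}, Real.exp (-onPath l y) * w y from rfl, setOf_shift_eq,
    finsum_mem_image hinj, ← Finset.coe_filter_univ, finsum_mem_coe_finset, Finset.sum_filter]
  refine Finset.sum_congr rfl fun e _ => ?_
  by_cases h : G.Adj e (x.1 0)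
  · rw [if_pos h, weight_of_adj h, onPath, cons_zero h]
  · rw [if_neg h, weight_of_not_adj h, zero_mul]

end Transfer

/-- Positive left and right eigenvectors of the weighted adjacency matrix, for the eigenvalue
one. -/
structure Perron (l : G.EdgeFun) where
  left : G.DEdge → ℝ
  right : G.DEdge → ℝ
  left_pos : ∀ e, 0 < left e
  right_pos : ∀ e, 0 < right e
  left_eq : ∀ e', ∑ e, weight l e e' * left e = left e'
  right_eq : ∀ e, ∑ e', weight l e e' * right e' = right e

section Normalized

variable {l : G.EdgeFun} (P : Perron l)

/-- Transition probabilities of the time-reversed Markov chain. -/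
def Perron.backward (e' e : G.DEdge) : ℝ := weight l e e' * P.left e / P.left e'

theorem Perron.backward_nonneg (e' e : G.DEdge) : 0 ≤ P.backward e' e :=
  div_nonneg (mul_nonneg (weight_nonneg l e e') (P.left_pos e).le) (P.left_pos e').le

theorem Perron.backward_pos {e' e : G.DEdge} (h : G.Adj e e') : 0 < P.backward e' e :=
  div_pos (mul_pos (weight_pos h) (P.left_pos e)) (P.left_pos e')

theorem Perron.backward_of_not_adj {e' e : G.DEdge} (h : ¬ G.Adj e e') : P.backward e' e = 0 := by
  simp [Perron.backward, weight_of_not_adj h]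

theorem Perron.sum_backward (e' : G.DEdge) : ∑ e, P.backward e' e = 1 := by
  simp only [Perron.backward, ← Finset.sum_div, P.left_eq, div_self (P.left_pos e').ne']

/-- The transfer operator of `-l`, conjugated by its eigenfunction so as to fix the constants. -/
def Perron.average (φ : G.Path → ℝ) (x : G.Path) : ℝ := ∑ e, P.backward (x.1 0) e * φ (cons e x)

theorem Perron.average_eq {φ : G.Path → ℝ} {x : G.Path} {F : G.DEdge → ℝ}
    (h : ∀ e, G.Adj e (x.1 0) → φ (cons e x) = F e) :
    P.average φ x = ∑ e, P.backward (x.1 0) e * F e := by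
  refine Finset.sum_congr rfl fun e _ => ?_
  by_cases he : G.Adj e (x.1 0)
  · rw [h e he]
  · rw [P.backward_of_not_adj he, zero_mul, zero_mul]

theorem Perron.average_one (x : G.Path) : P.average (fun _ => 1) x = 1 := by
  simp [Perron.average, P.sum_backward]

theorem Perron.average_mul_comp_shift (ψ w : G.Path → ℝ) (x : G.Path) :
    P.average (fun y => ψ y * w (shift y)) x = P.average ψ x * w x := by
  rw [P.average_eq (F := fun e => ψ (cons e x) * w x) fun e he => by rw [shift_cons he],
    Perron.average, Finset.sum_mul]
  simp only [mul_assoc]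

theorem Perron.continuous_average {φ : G.Path → ℝ} (hφ : Continuous φ) :
    Continuous (P.average φ) :=
  continuous_finsetSum _ fun e _ =>
    (continuous_comp_coord (fun e' => P.backward e' e) 0).mul (hφ.comp (continuous_cons e))

theorem Perron.transfer_eq_average (φ : G.Path → ℝ) (x : G.Path) :
    transfer (fun y => -onPath l y) (fun y => φ y * P.left (y.1 0)) x =
      P.left (x.1 0) * P.average φ x := by
  rw [transfer_eq_sum, Perron.average, Finset.mul_sum]
  refine Finset.sum_congr rfl fun e _ => ?_
  by_cases h : G.Adj e (x.1 0)
  · have := (P.left_pos (x.1 0)).ne'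
    rw [cons_zero h, Perron.backward]
    field_simp
  · simp [weight_of_not_adj h, P.backward_of_not_adj h]

theorem Perron.transfer_div_left (φ : G.Path → ℝ) (x : G.Path) :
    transfer (fun y => -onPath l y) φ x / P.left (x.1 0) =
      P.average (fun y => φ y / P.left (y.1 0)) x := by
  have h := P.transfer_eq_average (fun y => φ y / P.left (y.1 0)) x
  simp only [div_mul_cancel₀ _ (P.left_pos _).ne'] at h
  rw [h, mul_div_cancel_left₀ _ (P.left_pos _).ne']

/-- The set where a harmonic function attains its minimum is closed, and it is stable under
prepending edges, hence dense. -/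
theorem Perron.harmonic_eq_const (hG : G.Irreducible) {g : G.Path → ℝ} (hg : Continuous g)
    (h : ∀ x, P.average g x = g x) : ∃ c, ∀ x, g x = c := by
  rcases isEmpty_or_nonempty G.Path with hempty | hnonempty
  · exact ⟨0, fun x => (hempty.false x).elim⟩
  obtain ⟨x₀, -, hmin⟩ := isCompact_univ.exists_isMinOn (Set.univ_nonempty (α := G.Path))
    hg.continuousOn
  have hdense : Dense {x | g x = g x₀} :=
    hG.dense_of_cons_mem ⟨x₀, rfl⟩ fun x hx e he =>
      eq_of_forall_le_of_sum_mul_eq (a := fun e => g (cons e x)) (P.backward_nonneg (x.1 0))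
        (P.sum_backward (x.1 0)) (fun e => hmin (Set.mem_univ (cons e x))) ((h x).trans hx)
        (P.backward_pos he)
  exact ⟨g x₀, congrFun (hg.ext_on hdense continuous_const fun _ hx => hx)⟩

theorem Perron.eigenfunction_eq (hG : G.Irreducible) {v : G.Path → ℝ} (hv : Continuous v)
    (h : ∀ x, transfer (fun y => -onPath l y) v x = v x) : ∃ c, ∀ x, v x = c * P.left (x.1 0) := by
  have hne (x : G.Path) : P.left (x.1 0) ≠ 0 := (P.left_pos _).ne'
  obtain ⟨c, hc⟩ := P.harmonic_eq_const hG (g := fun x => v x / P.left (x.1 0))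
    (hv.div (continuous_comp_coord P.left 0) hne) fun x => by rw [← P.transfer_div_left, h]
  exact ⟨c, fun x => (div_eq_iff (hne x)).1 (hc x)⟩

theorem Perron.stationary_eq (hG : G.Irreducible) {p : G.DEdge → ℝ}
    (h : ∀ e, ∑ e', p e' * P.backward e' e = p e) :
    ∃ c, ∀ e, p e = c * (P.left e * P.right e) := by
  have hne (e : G.DEdge) : P.left e ≠ 0 := (P.left_pos e).ne'
  obtain ⟨c, hc⟩ := exists_eq_mul_of_irreducible (M := weight l) (r := fun e => p e / P.left e)
    (weight_nonneg l) (fun e e' => Relation.ReflTransGen.mono (fun _ _ => weight_pos) _ _ (hG e e'))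
    P.right_pos P.right_eq
    fun e => by
      rw [eq_div_iff (hne e), ← h e, Finset.sum_mul]
      refine Finset.sum_congr rfl fun e' _ => ?_
      have := hne e'
      rw [Perron.backward]
      field_simp
  exact ⟨c, fun e => by rw [(div_eq_iff (hne e)).1 (hc e), mul_assoc, mul_comm (P.right e)]⟩

/-- `m` is a probability measure fixed by the dual of the normalized transfer operator. -/
structure Perron.IsInvariant (m : Measure G.Path) : Prop where
  prob : IsProbabilityMeasure m
  integral_average : ∀ φ : G.Path → ℝ, Continuous φ → ∫ x, P.average φ x ∂m = ∫ x, φ x ∂m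

theorem Perron.exists_isInvariant [Nonempty G.Path] : ∃ m, P.IsInvariant m := by
  let A : C(G.Path, ℝ) →ₚ[ℝ] C(G.Path, ℝ) := .mk₀
    { toFun := fun φ => ⟨P.average φ, P.continuous_average φ.continuous⟩
      map_add' := fun φ ψ => by
        ext x; simp [Perron.average, mul_add, Finset.sum_add_distrib]
      map_smul' := fun c φ => by
        ext x; simp [Perron.average, Finset.mul_sum, mul_left_comm] }
    fun φ hφ x => Finset.sum_nonneg fun e _ => mul_nonneg (P.backward_nonneg _ e) (hφ _)
  obtain ⟨m, hm, hinv⟩ := exists_isProbabilityMeasure_integral_map_eq (A := A)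
    (ContinuousMap.ext P.average_one)
  exact ⟨m, hm, fun φ hφ => hinv ⟨φ, hφ⟩⟩

theorem Perron.exists_isEquilibriumState (P : Perron l) [Nonempty G.Path] :
    ∃ m, IsEquilibriumState (fun x => -onPath l x) m := by
  obtain ⟨m, hm, hinv⟩ := P.exists_isInvariant
  have hpos (x : G.Path) : 0 < (P.left (x.1 0))⁻¹ := inv_pos.2 (P.left_pos _)
  have hcont : Continuous fun x : G.Path => (P.left (x.1 0))⁻¹ :=
    continuous_comp_coord (fun e => (P.left e)⁻¹) 0
  refine ⟨_, fun x => P.left (x.1 0), m.tilted fun x => Real.log (P.left (x.1 0))⁻¹,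
    continuous_comp_coord _ _, fun x => P.left_pos _, fun x => ?_, ?_, fun φ hφ => ?_, rfl⟩
  · simpa [P.average_one] using P.transfer_eq_average (fun _ => 1) x
  · refine isProbabilityMeasure_tilted ?_
    simp only [Real.exp_log (hpos _)]
    exact integrable_of_continuous hcont m
  · simp only [integral_tilted_log hpos, ← div_eq_mul_inv, P.transfer_div_left]
    rw [hinv (fun x => φ x / P.left (x.1 0)) (hφ.div (continuous_comp_coord P.left 0)
      fun x => (P.left_pos _).ne')]

theorem Perron.isInvariant_of_isEquilibriumState (hG : G.Irreducible) {m : Measure G.Path}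
    (hm : IsEquilibriumState (fun x => -onPath l x) m) : P.IsInvariant m := by
  obtain ⟨v, μ, hv, hpos, heig, hμ, hdual, rfl⟩ := hm
  obtain ⟨c, hc⟩ := P.eigenfunction_eq hG hv heig
  have hint : Integrable (fun x => Real.exp (Real.log (v x))) μ := by
    simpa only [Real.exp_log (hpos _)] using integrable_of_continuous hv μ
  have hmass : 0 < ∫ x, v x ∂μ := by
    simpa only [Real.exp_log (hpos _)] using integral_exp_pos hint
  rw [inv_smul_withDensity_eq_tilted hpos hmass]
  refine ⟨isProbabilityMeasure_tilted hint, fun φ hφ => ?_⟩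
  have haverage (x : G.Path) : P.average φ x * v x =
      transfer (fun y => -onPath l y) (fun y => φ y * v y) x := by
    have h := P.transfer_eq_average (fun y => c * φ y) x
    have hv' : (fun y => c * φ y * P.left (y.1 0)) = fun y => φ y * v y := by
      funext y; rw [hc]; ring
    rw [← hv', h, hc, Perron.average, Perron.average, Finset.sum_mul, Finset.mul_sum]
    exact Finset.sum_congr rfl fun e _ => by ring
  simp only [integral_tilted_log hpos, haverage]
  rw [hdual (fun y => φ y * v y) (hφ.mul hv)]

end Normalized

section Uniqueness

variable {l : G.EdgeFun} {P : Perron l} {m : Measure G.Path}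

theorem continuous_indicator_one {s : Set G.Path} (hs : IsClopen s) :
    Continuous (s.indicator (1 : G.Path → ℝ)) :=
  continuous_indicator (by simp [hs.frontier_eq]) continuousOn_const

/-- The probability of the first edge. -/
def headProb (m : Measure G.Path) (e : G.DEdge) : ℝ := m.real {x | x.1 0 = e}

theorem isClopen_head_eq (e : G.DEdge) : IsClopen {x : G.Path | x.1 0 = e} :=
  (isClopen_discrete {e}).preimage (continuous_coord 0)

theorem integral_comp_head (m : Measure G.Path) [IsFiniteMeasure m] (F : G.DEdge → ℝ) :
    ∫ x, F (x.1 0) ∂m = ∑ e, headProb m e * F e := by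
  rw [← integral_map (continuous_coord 0).measurable.aemeasurable
    continuous_of_discreteTopology.aestronglyMeasurable, integral_fintype .of_finite]
  refine Finset.sum_congr rfl fun e _ => ?_
  rw [map_measureReal_apply (continuous_coord 0).measurable (measurableSet_singleton e)]
  rfl

theorem Perron.IsInvariant.integral_average_indicator (hm : P.IsInvariant m) {s : Set G.Path}
    (hs : IsClopen s) : ∫ x, P.average (s.indicator 1) x ∂m = m.real s := by
  rw [hm.integral_average _ (continuous_indicator_one hs),
    integral_indicator_one hs.isOpen.measurableSet]

theorem Perron.IsInvariant.headProb_stationary (hm : P.IsInvariant m) (e : G.DEdge) :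
    ∑ e', headProb m e' * P.backward e' e = headProb m e := by
  have := hm.prob
  rw [← integral_comp_head m fun e' => P.backward e' e, headProb,
    ← hm.integral_average_indicator (isClopen_head_eq e)]
  refine integral_congr_ae (.of_forall fun x => ?_)
  simp only
  rw [P.average_eq (F := fun e' => if e' = e then 1 else 0)
    fun e' he' => by simp [Set.indicator_apply, cons_zero he']]
  simp

theorem Perron.IsInvariant.headProb_eq (hm : P.IsInvariant m) (hG : G.Irreducible) (e : G.DEdge) :
    headProb m e = P.left e * P.right e / ∑ e, P.left e * P.right e := by
  have := hm.prob
  obtain ⟨c, hc⟩ := P.stationary_eq hG hm.headProb_stationary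
  have htotal : ∑ e, headProb m e = 1 := by
    simpa using (integral_comp_head m fun _ => 1).symm
  simp only [hc, ← Finset.mul_sum] at htotal
  rw [hc, div_eq_mul_inv, mul_comm, ← eq_inv_of_mul_eq_one_left htotal]

theorem Perron.IsInvariant.measure_cyl_succ (hm : P.IsInvariant m) (n : ℕ) (y : ℕ → G.DEdge) :
    m.real (cyl (n + 2) y) =
      P.backward (y 1) (y 0) * m.real (cyl (n + 1) fun i => y (i + 1)) := by
  rw [← hm.integral_average_indicator (isClopen_cyl _ _),
    ← integral_indicator_one (isClopen_cyl _ _).isOpen.measurableSet, ← integral_const_mul]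
  refine integral_congr_ae (.of_forall fun x => ?_)
  have hcons (e : G.DEdge) (he : G.Adj e (x.1 0)) : cons e x ∈ cyl (n + 2) y ↔
      e = y 0 ∧ x ∈ cyl (n + 1) fun i => y (i + 1) := by
    rw [mem_cyl_succ, cons_zero he]
    simp only [cons_succ he]
    rfl
  by_cases hx : x ∈ cyl (n + 1) fun i => y (i + 1)
  · have hx0 : x.1 0 = y 1 := hx 0 n.succ_pos
    simp only
    rw [P.average_eq (F := fun e => if e = y 0 then 1 else 0)
      fun e he => by simp [Set.indicator, hcons e he, hx]]
    simp [hx, hx0]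
  · simp only
    rw [P.average_eq (F := fun _ => 0)
      fun e he => by simp [hcons e he, hx]]
    simp [hx]

theorem Perron.IsInvariant.unique (hm : P.IsInvariant m) (hG : G.Irreducible)
    {m' : Measure G.Path} (hm' : P.IsInvariant m') : m = m' := by
  have := hm.prob
  have := hm'.prob
  refine measure_ext_of_cyl fun n y => ?_
  induction n generalizing y with
  | zero => simp [cyl]
  | succ n ih =>
    cases n with
    | zero =>
      have hcyl : cyl (0 + 1) y = {x | x.1 0 = y 0} := by ext; simp [cyl]
      rw [hcyl]
      exact (hm.headProb_eq hG (y 0)).trans (hm'.headProb_eq hG (y 0)).symm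
    | succ n => rw [hm.measure_cyl_succ, hm'.measure_cyl_succ, ih]

theorem Perron.existsUnique_isEquilibriumState (P : Perron l) [Nonempty G.Path]
    (hG : G.Irreducible) : ∃! m, IsEquilibriumState (fun x => -onPath l x) m := by
  obtain ⟨m, hm⟩ := P.exists_isEquilibriumState
  exact ⟨m, hm, fun m' hm' => (P.isInvariant_of_isEquilibriumState hG hm').unique hG
    (P.isInvariant_of_isEquilibriumState hG hm)⟩

theorem Perron.isInvariant_eqState (P : Perron l) [Nonempty G.Path] (hG : G.Irreducible) :
    P.IsInvariant (eqState l) := by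
  have h := P.exists_isEquilibriumState
  refine P.isInvariant_of_isEquilibriumState hG ?_
  rw [eqState, equilibriumState, dif_pos h]
  exact h.choose_spec

end Uniqueness

end FinGraph

/-! ### The variance by Poisson's equation -/

section SecondMoment

variable {Ω : Type*} [MeasurableSpace Ω] {m : Measure Ω}

theorem lpNorm_two_sq {f : Ω → ℝ} (hf : AEStronglyMeasurable f m) :
    lpNorm f 2 m ^ 2 = ∫ x, f x ^ 2 ∂m := by
  have hnonneg : 0 ≤ ∫ x, ‖f x‖ ^ 2 ∂m := integral_nonneg fun x => by positivity
  rw [lpNorm_eq_integral_norm_rpow_toReal two_ne_zero ENNReal.ofNat_ne_top hf, ENNReal.toReal_ofNat]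
  simp only [Real.rpow_two]
  rw [← one_div, ← Real.sqrt_eq_rpow, Real.sq_sqrt hnonneg]
  simp only [Real.norm_eq_abs, sq_abs]

variable [IsProbabilityMeasure m]

theorem abs_lpNorm_add_sub_le {f g : Ω → ℝ} {K : ℝ} (hg : AEStronglyMeasurable g m)
    (hgK : ∀ x, |g x| ≤ K) : |lpNorm (f + g) 2 m - lpNorm f 2 m| ≤ K := by
  obtain ⟨x₀⟩ := m.nonempty_of_neZero
  have hK : 0 ≤ K := (abs_nonneg (g x₀)).trans (hgK x₀)
  have hgmem : MemLp g 2 m := .of_bound hg K (.of_forall hgK)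
  have hgnorm : lpNorm g 2 m ≤ K :=
    calc lpNorm g 2 m ≤ lpNorm (fun _ : Ω => K) 2 m := lpNorm_mono_real (memLp_const K) hgK
      _ = |K| := by simp
      _ = K := abs_of_nonneg hK
  rw [abs_le]
  constructor
  · linarith [lpNorm_le_add_lpNorm_add (f := f) hgmem one_le_two]
  · linarith [lpNorm_add_le' (f := f) hgmem one_le_two]

/-- Perturbing a sequence whose second moments grow like `n s` by bounded functions does not change
the growth rate of the second moments. -/
theorem tendsto_integral_add_sq_div {M D : ℕ → Ω → ℝ} {s K : ℝ}
    (hM : ∀ n, AEStronglyMeasurable (M n) m) (hD : ∀ n, AEStronglyMeasurable (D n) m)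
    (hs : ∀ n, ∫ x, M n x ^ 2 ∂m = n * s) (hDK : ∀ n x, |D n x| ≤ K) :
    Tendsto (fun n : ℕ => 1 / (n : ℝ) * ∫ x, (M n x + D n x) ^ 2 ∂m) atTop (𝓝 s) := by
  have hs0 : 0 ≤ s := by
    simpa only [hs, Nat.cast_one, one_mul] using
      integral_nonneg (μ := m) (f := fun x => M 1 x ^ 2) fun x => sq_nonneg (M 1 x)
  have hroot : Tendsto (fun n : ℕ => √(n : ℝ)) atTop atTop :=
    Real.tendsto_sqrt_atTop.comp tendsto_natCast_atTop_atTop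
  have herr : Tendsto (fun n : ℕ => (lpNorm (M n + D n) 2 m - lpNorm (M n) 2 m) / √(n : ℝ)) atTop
      (𝓝 0) :=
    tendsto_bdd_div_atTop_nhds_zero
      (.of_forall fun n => (abs_le.1 (abs_lpNorm_add_sub_le (hD n) (hDK n))).1)
      (.of_forall fun n => (abs_le.1 (abs_lpNorm_add_sub_le (hD n) (hDK n))).2) hroot
  have hlim := (herr.add_const (√s)).pow 2
  rw [zero_add, Real.sq_sqrt hs0] at hlim
  refine hlim.congr' ?_
  filter_upwards [eventually_gt_atTop 0] with n hn
  have hn' : (0 : ℝ) < n := Nat.cast_pos.2 hn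
  have hMn : lpNorm (M n) 2 m = √n * √s := by
    rw [← Real.sqrt_mul hn'.le, ← hs, ← lpNorm_two_sq (hM n), Real.sqrt_sq lpNorm_nonneg]
  have hsum : ∫ x, (M n x + D n x) ^ 2 ∂m = lpNorm (M n + D n) 2 m ^ 2 :=
    (lpNorm_two_sq ((hM n).add (hD n))).symm
  rw [hsum, hMn, sub_div, mul_div_cancel_left₀ _ (Real.sqrt_pos.2 hn').ne', sub_add_cancel, div_pow,
    Real.sq_sqrt hn'.le, one_div_mul_eq_div]

end SecondMoment

namespace FinGraph

variable {G : FinGraph} {l : G.EdgeFun} {P : Perron l} {m : Measure G.Path}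

theorem Perron.IsInvariant.integral_comp_shift (hm : P.IsInvariant m) {w : G.Path → ℝ}
    (hw : Continuous w) : ∫ x, w (shift x) ∂m = ∫ x, w x ∂m := by
  rw [← hm.integral_average (fun x => w (shift x)) (hw.comp continuous_shift)]
  refine integral_congr_ae (.of_forall fun x => ?_)
  simpa [P.average_one] using P.average_mul_comp_shift (fun _ => 1) w x

theorem continuous_birkhoffSum {ψ : G.Path → ℝ} (hψ : Continuous ψ) (n : ℕ) :
    Continuous (birkhoffSum shift ψ n) :=
  continuous_finsetSum _ fun i _ => hψ.comp (continuous_shift.iterate i)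

/-- The terms of the Birkhoff sum are orthogonal. -/
theorem Perron.IsInvariant.integral_birkhoffSum_sq (hm : P.IsInvariant m) {ψ : G.Path → ℝ}
    (hψ : Continuous ψ) (hψ0 : ∀ x, P.average ψ x = 0) (n : ℕ) :
    ∫ x, birkhoffSum shift ψ n x ^ 2 ∂m = n * ∫ x, ψ x ^ 2 ∂m := by
  have := hm.prob
  induction n with
  | zero => simp
  | succ n ih =>
    let S : G.Path → ℝ := birkhoffSum shift ψ n
    have hS : Continuous S := continuous_birkhoffSum hψ n
    have hcross : Continuous fun x => ψ x * S (shift x) := hψ.mul (hS.comp continuous_shift)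
    have hsquare : Continuous fun x => S (shift x) ^ 2 := (hS.comp continuous_shift).pow 2
    have htwice : Continuous fun x => 2 * (ψ x * S (shift x)) := continuous_const.mul hcross
    have hrest : Continuous fun x => 2 * (ψ x * S (shift x)) + S (shift x) ^ 2 :=
      htwice.add hsquare
    have hψsq : Continuous fun x => ψ x ^ 2 := hψ.pow 2
    have horth : ∫ x, ψ x * S (shift x) ∂m = 0 := by
      rw [← hm.integral_average _ hcross]
      simp [P.average_mul_comp_shift, hψ0]
    calc ∫ x, birkhoffSum shift ψ (n + 1) x ^ 2 ∂m
        = ∫ x, ψ x ^ 2 + (2 * (ψ x * S (shift x)) + S (shift x) ^ 2) ∂m := by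
          simp only [birkhoffSum_succ', S]
          exact integral_congr_ae (.of_forall fun x => by ring)
      _ = ∫ x, ψ x ^ 2 ∂m + (2 * ∫ x, ψ x * S (shift x) ∂m + ∫ x, S (shift x) ^ 2 ∂m) := by
          rw [integral_add (integrable_of_continuous hψsq m) (integrable_of_continuous hrest m),
            integral_add (integrable_of_continuous htwice m) (integrable_of_continuous hsquare m),
            integral_const_mul]
      _ = (n + 1 : ℕ) * ∫ x, ψ x ^ 2 ∂m := by
          rw [horth, hm.integral_comp_shift (w := fun x => S x ^ 2) (hS.pow 2), ih]
          push_cast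
          ring

section Poisson

variable (P)

/-- The conditional mean of `H` under the reversed Markov chain. -/
def Perron.condMean (H : G.DEdge → ℝ) (e' : G.DEdge) : ℝ := ∑ e, P.backward e' e * H e

/-- The martingale difference `H(e₀) - 𝔼[H(e₀) | e₁, e₂, …]`. -/
def Perron.fluctuation (H : G.DEdge → ℝ) (x : G.Path) : ℝ := H (x.1 0) - P.condMean H (x.1 1)

variable (H : G.DEdge → ℝ)

theorem Perron.continuous_fluctuation : Continuous (P.fluctuation H) :=
  (continuous_comp_coord H 0).sub (continuous_comp_coord (P.condMean H) 1)

theorem Perron.fluctuation_cons {x : G.Path} {e : G.DEdge} (he : G.Adj e (x.1 0)) :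
    P.fluctuation H (cons e x) = H e - P.condMean H (x.1 0) := by
  rw [Perron.fluctuation, cons_zero he, cons_succ he]

theorem Perron.average_fluctuation (x : G.Path) : P.average (P.fluctuation H) x = 0 := by
  rw [P.average_eq fun e he => P.fluctuation_cons H he]
  simp only [mul_sub, Finset.sum_sub_distrib, ← Finset.sum_mul, P.sum_backward, one_mul]
  exact sub_self _

variable {P H}

theorem Perron.IsInvariant.integral_fluctuation_sq (hm : P.IsInvariant m) :
    ∫ x, P.fluctuation H x ^ 2 ∂m =
      ∑ e', headProb m e' * ∑ e, P.backward e' e * (H e - P.condMean H e') ^ 2 := by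
  have := hm.prob
  rw [← hm.integral_average (fun x => P.fluctuation H x ^ 2) ((P.continuous_fluctuation H).pow 2),
    ← integral_comp_head]
  exact integral_congr_ae (.of_forall fun x =>
    P.average_eq fun e he => by rw [P.fluctuation_cons H he])

variable {φ : G.EdgeFun} {c : ℝ} (hH : ∀ e', H e' = φ e'.1 - c + P.condMean H e')

include hH
theorem Perron.onPath_eq_fluctuation_add (x : G.Path) : onPath φ x =
    c + P.fluctuation H x + (P.condMean H ((shift x).1 0) - P.condMean H (x.1 0)) := by
  have h := hH (x.1 0)
  simp only [onPath, Perron.fluctuation, shift]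
  linarith

/-- Sum the coboundary decomposition `Perron.onPath_eq_fluctuation_add` along the orbit. -/
theorem Perron.birkhoffSum_onPath_sub (n : ℕ) (x : G.Path) :
    birkhoffSum shift (onPath φ) n x - n * c = birkhoffSum shift (P.fluctuation H) n x +
      (P.condMean H ((shift^[n] x).1 0) - P.condMean H (x.1 0)) := by
  induction n with
  | zero => simp
  | succ n ih =>
    rw [birkhoffSum_succ, birkhoffSum_succ, Perron.onPath_eq_fluctuation_add hH,
      Function.iterate_succ_apply']
    push_cast
    linarith

theorem Perron.IsInvariant.integral_onPath (hm : P.IsInvariant m) : ∫ x, onPath φ x ∂m = c := by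
  have := hm.prob
  have hcm : Continuous fun x : G.Path => P.condMean H (x.1 0) :=
    continuous_comp_coord (P.condMean H) 0
  have hcs : Continuous fun x : G.Path => P.condMean H ((shift x).1 0) := hcm.comp continuous_shift
  have hfl := P.continuous_fluctuation H
  have hcfl : Continuous fun x => c + P.fluctuation H x := continuous_const.add hfl
  have hcob : Continuous fun x : G.Path => P.condMean H ((shift x).1 0) - P.condMean H (x.1 0) :=
    hcs.sub hcm
  simp only [Perron.onPath_eq_fluctuation_add hH]
  rw [integral_add (integrable_of_continuous hcfl m) (integrable_of_continuous hcob m),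
    integral_add (integrable_const c) (integrable_of_continuous hfl m),
    integral_sub (integrable_of_continuous hcs m) (integrable_of_continuous hcm m),
    hm.integral_comp_shift hcm, ← hm.integral_average _ hfl]
  simp [P.average_fluctuation]

theorem Perron.IsInvariant.tendsto_varianceSeq (hm : P.IsInvariant m) :
    Tendsto (varianceSeq (onPath φ) m) atTop (𝓝 (∑ e', headProb m e' *
      ∑ e, P.backward e' e * (H e - P.condMean H e') ^ 2)) := by
  have := hm.prob
  have hfl := P.continuous_fluctuation H
  have hcm : Continuous fun x : G.Path => P.condMean H (x.1 0) :=
    continuous_comp_coord (P.condMean H) 0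
  have hle (e : G.DEdge) : |P.condMean H e| ≤ ∑ e, |P.condMean H e| :=
    Finset.single_le_sum (f := fun e => |P.condMean H e|) (fun _ _ => abs_nonneg _)
      (Finset.mem_univ e)
  rw [← hm.integral_fluctuation_sq]
  refine (tendsto_integral_add_sq_div (M := fun n => birkhoffSum shift (P.fluctuation H) n)
    (D := fun n x => P.condMean H ((shift^[n] x).1 0) - P.condMean H (x.1 0))
    (K := 2 * ∑ e, |P.condMean H e|)
    (fun n => (continuous_birkhoffSum hfl n).aestronglyMeasurable)
    (fun n => ((hcm.comp (continuous_shift.iterate n)).sub hcm).aestronglyMeasurable)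
    (hm.integral_birkhoffSum_sq hfl (P.average_fluctuation H)) fun n x => ?_).congr fun n => ?_
  · refine (abs_sub _ _).trans ?_
    linarith [hle ((shift^[n] x).1 0), hle (x.1 0)]
  · simp only [varianceSeq, hm.integral_onPath hH, Perron.birkhoffSum_onPath_sub hH]

end Poisson

end FinGraph

/-! ### Entropy by counting paths -/

theorem one_div_mul_log_mul_exp {k h T : ℝ} (hk : 0 < k) (hT : 0 < T) :
    1 / T * Real.log (k * Real.exp (h * T)) = 1 / T * Real.log k + h := by
  rw [Real.log_mul hk.ne' (Real.exp_pos _).ne', Real.log_exp]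
  field_simp

theorem tendsto_log_div_of_exp_bounds {N : ℝ → ℝ} {h c C : ℝ} (hh : 0 < h) (hc : 0 < c)
    (hlow : ∀ᶠ T in atTop, c * Real.exp (h * T) - 1 ≤ N T)
    (hup : ∀ᶠ T in atTop, N T ≤ C * T * Real.exp (h * T)) :
    Tendsto (fun T : ℝ => 1 / T * Real.log (N T)) atTop (𝓝 h) := by
  have hinv : Tendsto (fun T : ℝ => 1 / T) atTop (𝓝 0) := by
    simpa only [one_div] using tendsto_inv_atTop_zero
  have hlog : Tendsto (fun T : ℝ => Real.log T / T) atTop (𝓝 0) :=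
    Real.isLittleO_log_id_atTop.tendsto_div_nhds_zero
  have hexp : Tendsto (fun T : ℝ => c / 2 * Real.exp (h * T)) atTop atTop :=
    (Real.tendsto_exp_atTop.comp (tendsto_id.const_mul_atTop hh)).const_mul_atTop (by positivity)
  have hlower : Tendsto (fun T : ℝ => 1 / T * Real.log (c / 2) + h) atTop (𝓝 h) := by
    simpa using (hinv.mul_const (Real.log (c / 2))).add_const h
  have hupper : Tendsto (fun T : ℝ => 1 / T * Real.log C + Real.log T / T + h) atTop (𝓝 h) := by
    simpa using ((hinv.mul_const (Real.log C)).add hlog).add_const h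
  have hhalf : ∀ᶠ T in atTop, c / 2 * Real.exp (h * T) ≤ N T := by
    filter_upwards [hlow, hexp.eventually_ge_atTop 1] with T hN h1
    linarith
  refine tendsto_of_tendsto_of_tendsto_of_le_of_le' hlower hupper ?_ ?_
  · filter_upwards [hhalf, eventually_gt_atTop 0] with T hN hT
    rw [← one_div_mul_log_mul_exp (half_pos hc) hT]
    gcongr
  · filter_upwards [hhalf, hup, eventually_gt_atTop 0] with T hNlow hN hT
    have hNpos : 0 < N T := lt_of_lt_of_le (by positivity) hNlow
    have hCT : 0 < C * T := pos_of_mul_pos_left (hNpos.trans_le hN) (Real.exp_pos _).le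
    calc 1 / T * Real.log (N T) ≤ 1 / T * Real.log (C * T * Real.exp (h * T)) := by gcongr
      _ = 1 / T * Real.log C + Real.log T / T + h := by
        rw [one_div_mul_log_mul_exp hCT hT,
          Real.log_mul (pos_of_mul_pos_left hCT hT.le).ne' hT.ne']
        ring

namespace FinGraph

variable {G : FinGraph} {l : G.EdgeFun}

section FinitePaths

/-- Finite non-backtracking paths from `e` to `a` of length less than `T`, where the last edge `a`
does not count towards the length. -/
def pathsTo (l : G.EdgeFun) (a e : G.DEdge) (T : ℝ) : Set (Σ n : ℕ, Fin (n + 1) → G.DEdge) :=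
  {γ | (∀ i : Fin γ.1, G.Adj (γ.2 i.castSucc) (γ.2 i.succ)) ∧ γ.2 0 = e ∧
    γ.2 (Fin.last γ.1) = a ∧ ∑ i : Fin γ.1, l (γ.2 i.castSucc).1 < T}

/-- Prepend a directed edge to a finite sequence. -/
def finCons (e : G.DEdge) (γ : Σ n : ℕ, Fin (n + 1) → G.DEdge) : Σ n : ℕ, Fin (n + 1) → G.DEdge :=
  ⟨γ.1 + 1, Fin.cons e γ.2⟩

theorem finCons_injective (e : G.DEdge) : Function.Injective (finCons e) := by
  rintro ⟨n, γ⟩ ⟨n', γ'⟩ h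
  simp only [finCons, Sigma.mk.injEq, Nat.add_right_cancel_iff] at h
  obtain ⟨rfl, h⟩ := h
  rw [Fin.cons_right_injective _ (eq_of_heq h)]

theorem finCons_mem_pathsTo {a e e' : G.DEdge} (he : G.Adj e e') {T : ℝ}
    {γ : Σ n : ℕ, Fin (n + 1) → G.DEdge} (hγ : γ ∈ pathsTo l a e' (T - l e.1)) :
    finCons e γ ∈ pathsTo l a e T := by
  obtain ⟨n, γ⟩ := γ
  obtain ⟨hadj, hfirst, hlast, hlen⟩ := hγ
  refine ⟨Fin.cases (by rw [← hfirst] at he; exact he) hadj, rfl, ?_, ?_⟩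
  · simpa [finCons, ← Fin.succ_last] using hlast
  · change ∑ i : Fin (n + 1), l ((Fin.cons e γ : Fin (n + 2) → G.DEdge) i.castSucc).1 < T
    rw [Fin.sum_univ_succ]
    exact lt_sub_iff_add_lt'.1 hlen

theorem eq_const_of_mem_pathsTo {a e : G.DEdge} {T : ℝ} {γ : Fin 1 → G.DEdge}
    (hγ : ⟨0, γ⟩ ∈ pathsTo l a e T) : γ = fun _ => e := by
  funext i
  rw [Subsingleton.elim i 0]
  exact hγ.2.1

theorem pathsTo_subset (l : G.EdgeFun) (a e : G.DEdge) (T : ℝ) : pathsTo l a e T ⊆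
    {⟨0, fun _ => e⟩} ∪ ⋃ e' ∈ Finset.univ.filter (G.Adj e),
      finCons e '' pathsTo l a e' (T - l e.1) := by
  rintro ⟨n, γ⟩ hγ
  cases n with
  | zero =>
    left
    rw [eq_const_of_mem_pathsTo hγ]
    rfl
  | succ n =>
    obtain ⟨hadj, rfl, hlast, hlen⟩ := hγ
    rw [Fin.sum_univ_succ] at hlen
    right
    simp only [Set.mem_iUnion, Finset.mem_filter, Finset.mem_univ, true_and]
    exact ⟨γ 1, hadj 0, ⟨n, Fin.tail γ⟩, ⟨fun i => hadj i.succ, rfl, hlast,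
      lt_sub_iff_add_lt'.2 hlen⟩, congrArg (Sigma.mk (n + 1)) (Fin.cons_self_tail γ)⟩

theorem exists_pos_le (hl : ∀ e, 0 < l e) : ∃ δ > 0, ∀ e, δ ≤ l e := by
  rcases isEmpty_or_nonempty (Fin G.numEdges) with hE | hE
  · exact ⟨1, one_pos, fun e => (hE.false e).elim⟩
  · obtain ⟨e₀, h⟩ := Finite.exists_min l
    exact ⟨l e₀, hl e₀, h⟩

theorem exists_forall_le {ι : Type*} [Finite ι] (f : ι → ℝ) : ∃ K, ∀ i, f i ≤ K :=
  (Set.finite_range f).bddAbove.imp fun _ hK i => hK ⟨i, rfl⟩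

theorem finite_pathsTo (hl : ∀ e, 0 < l e) (a e : G.DEdge) (T : ℝ) : (pathsTo l a e T).Finite := by
  obtain ⟨δ, hδ, hle⟩ := exists_pos_le hl
  obtain ⟨N, hN⟩ := exists_nat_gt (T / δ)
  have hfin : (⋃ n ∈ Set.Iio N, Set.range fun γ : Fin (n + 1) → G.DEdge =>
      (⟨n, γ⟩ : Σ n : ℕ, Fin (n + 1) → G.DEdge)).Finite :=
    (Set.finite_Iio N).biUnion fun n _ => Set.finite_range _
  refine hfin.subset ?_
  rintro ⟨n, γ⟩ ⟨-, -, -, hlen⟩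
  have hnδ : n * δ ≤ ∑ i : Fin n, l (γ i.castSucc).1 := by
    simpa using Finset.card_nsmul_le_sum Finset.univ (fun i : Fin n => l (γ i.castSucc).1) δ
      fun i _ => hle _
  have hn : (n : ℝ) < N := ((lt_div_iff₀ hδ).2 (hnδ.trans_lt hlen)).trans hN
  simp only [Set.mem_iUnion, Set.mem_Iio, Set.mem_range]
  exact ⟨n, by exact_mod_cast hn, γ, rfl⟩

theorem pathsTo_eq_empty (hl : ∀ e, 0 < l e) (a e : G.DEdge) {T : ℝ} (hT : T ≤ 0) :
    pathsTo l a e T = ∅ :=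
  Set.eq_empty_of_forall_notMem fun γ hγ =>
    (Finset.sum_nonneg fun i _ => (hl (γ.2 i.castSucc).1).le).not_gt (hγ.2.2.2.trans_le hT)

theorem ncard_pathsTo_le (hl : ∀ e, 0 < l e) (a e : G.DEdge) (T : ℝ) :
    (pathsTo l a e T).ncard ≤
      1 + ∑ e' ∈ Finset.univ.filter (G.Adj e), (pathsTo l a e' (T - l e.1)).ncard := by
  have hfin : (⋃ e' ∈ Finset.univ.filter (G.Adj e),
      finCons e '' pathsTo l a e' (T - l e.1)).Finite :=
    (Finset.finite_toSet _).biUnion fun e' _ => (finite_pathsTo hl _ _ _).image _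
  refine (Set.ncard_le_ncard (pathsTo_subset l a e T) ((Set.finite_singleton _).union hfin)).trans
    ((Set.ncard_union_le _ _).trans ?_)
  rw [Set.ncard_singleton]
  refine Nat.add_le_add_left ((Finset.set_ncard_biUnion_le _ _).trans ?_) 1
  exact Finset.sum_le_sum fun e' _ => Set.ncard_image_le (finite_pathsTo hl _ _ _)

theorem sum_ncard_pathsTo_le (hl : ∀ e, 0 < l e) (a e : G.DEdge) (T : ℝ) :
    ∑ e' ∈ Finset.univ.filter (G.Adj e), (pathsTo l a e' (T - l e.1)).ncard ≤
      (pathsTo l a e T).ncard := by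
  have : Finite (pathsTo l a e T) := finite_pathsTo hl a e T
  have (e' : G.DEdge) : Finite (pathsTo l a e' (T - l e.1)) := finite_pathsTo hl a e' _
  calc ∑ e' ∈ Finset.univ.filter (G.Adj e), (pathsTo l a e' (T - l e.1)).ncard
      = Nat.card (Σ e' : {e' // G.Adj e e'}, pathsTo l a e'.1 (T - l e.1)) := by
        rw [Nat.card_sigma, Finset.sum_subtype (p := G.Adj e) _ (by simp)]
        rfl
    _ ≤ Nat.card (pathsTo l a e T) := by
        refine Nat.card_le_card_of_injective
          (fun p => ⟨finCons e p.2.1, finCons_mem_pathsTo p.1.2 p.2.2⟩) ?_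
        rintro ⟨⟨e₁, he₁⟩, γ₁, hγ₁⟩ ⟨⟨e₂, he₂⟩, γ₂, hγ₂⟩ h
        obtain rfl : γ₁ = γ₂ := finCons_injective e (congrArg Subtype.val h)
        obtain rfl : e₁ = e₂ := hγ₁.2.1.symm.trans hγ₂.2.1
        rfl
    _ = (pathsTo l a e T).ncard := Nat.card_coe_set_eq _

theorem exists_one_le_ncard_pathsTo (hl : ∀ e, 0 < l e) (hG : G.Irreducible) (a : G.DEdge) :
    ∃ M, ∀ e T, M < T → 1 ≤ (pathsTo l a e T).ncard := by
  have hpath (e : G.DEdge) : ∃ M, ∀ T, M < T → 1 ≤ (pathsTo l a e T).ncard := by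
    induction hG e a using Relation.ReflTransGen.head_induction_on with
    | refl =>
      refine ⟨0, fun T hT => (Set.ncard_pos (finite_pathsTo hl _ _ _)).2 ?_⟩
      exact ⟨⟨0, fun _ => a⟩, fun i => i.elim0, rfl, rfl, by simpa using hT⟩
    | @head b c hbc _ ih =>
      obtain ⟨M, hM⟩ := ih
      refine ⟨M + l b.1, fun T hT => (hM (T - l b.1) (lt_sub_iff_add_lt.2 hT)).trans
        (le_trans ?_ (sum_ncard_pathsTo_le hl a b T))⟩
      exact Finset.single_le_sum (f := fun e' => (pathsTo l a e' (T - l b.1)).ncard)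
        (fun _ _ => Nat.zero_le _) (by simpa using hbc)
  choose M hM using hpath
  obtain ⟨K, hK⟩ := exists_forall_le M
  exact ⟨K, fun e T hT => hM e T ((hK e).trans_lt hT)⟩

theorem cyclesBelow_subset (l : G.EdgeFun) (T : ℝ) :
    G.cyclesBelow l T ⊆ ⋃ b ∈ (Finset.univ : Finset G.DEdge), pathsTo l b b T := by
  rintro γ ⟨-, hadj, hclosed, hlen⟩
  simp only [Set.mem_iUnion, Finset.mem_univ, exists_const]
  exact ⟨γ.2 0, hadj, rfl, hclosed, hlen⟩

theorem finite_biUnion_pathsTo (hl : ∀ e, 0 < l e) (T : ℝ) :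
    (⋃ b ∈ (Finset.univ : Finset G.DEdge), pathsTo l b b T).Finite :=
  (Finset.finite_toSet _).biUnion fun b _ => finite_pathsTo hl b b T

theorem ncard_cyclesBelow_le (hl : ∀ e, 0 < l e) (T : ℝ) :
    (G.cyclesBelow l T).ncard ≤ ∑ b, (pathsTo l b b T).ncard :=
  (Set.ncard_le_ncard (cyclesBelow_subset l T) (finite_biUnion_pathsTo hl T)).trans
    (Finset.set_ncard_biUnion_le _ _)

theorem ncard_pathsTo_self_le (hl : ∀ e, 0 < l e) (a : G.DEdge) (T : ℝ) :
    (pathsTo l a a T).ncard ≤ (G.cyclesBelow l T).ncard + 1 := by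
  have hsub : pathsTo l a a T ⊆ G.cyclesBelow l T ∪ {⟨0, fun _ => a⟩} := by
    rintro ⟨n, γ⟩ hγ
    cases n with
    | zero =>
      right
      rw [eq_const_of_mem_pathsTo hγ]
      rfl
    | succ n =>
      obtain ⟨hadj, hfirst, hlast, hlen⟩ := hγ
      exact Or.inl ⟨by simp, hadj, hlast.trans hfirst.symm, hlen⟩
  have hfin : (G.cyclesBelow l T).Finite :=
    (finite_biUnion_pathsTo hl T).subset (cyclesBelow_subset l T)
  refine (Set.ncard_le_ncard hsub (hfin.union (Set.finite_singleton _))).trans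
    ((Set.ncard_union_le _ _).trans ?_)
  rw [Set.ncard_singleton]

end FinitePaths

section Eigenvector

variable {h : ℝ} {u : G.DEdge → ℝ}

theorem sum_adj_exp_mul (hu : ∀ e, ∑ e', weight (h • l) e e' * u e' = u e) (e : G.DEdge) (T : ℝ) :
    ∑ e' ∈ Finset.univ.filter (G.Adj e), u e' * Real.exp (h * (T - l e.1)) =
      u e * Real.exp (h * T) := by
  rw [← hu e, Finset.sum_filter, Finset.sum_mul]
  refine Finset.sum_congr rfl fun e' _ => ?_
  by_cases he : G.Adj e e'
  · rw [if_pos he, weight_of_adj he, mul_right_comm, ← Real.exp_add, mul_comm, Pi.smul_apply,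
      smul_eq_mul]
    ring_nf
  · rw [if_neg he, weight_of_not_adj he, zero_mul, zero_mul]

variable (hl : ∀ e, 0 < l e) (hh : 0 ≤ h)
  (hu : ∀ e, ∑ e', weight (h • l) e e' * u e' = u e)
include hl hh hu

theorem ncard_pathsTo_le_exp {δ C : ℝ} (hδ : ∀ e, δ ≤ l e) (hC : ∀ e, 1 ≤ C * u e) (a : G.DEdge)
    (n : ℕ) (e : G.DEdge) {T : ℝ} (hT : T ≤ n * δ) :
    ((pathsTo l a e T).ncard : ℝ) ≤ n * (C * u e * Real.exp (h * T)) := by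
  induction n generalizing e T with
  | zero => simp [pathsTo_eq_empty hl a e (T := T) (by simpa using hT)]
  | succ n ih =>
    have hpos : 0 ≤ C * u e := zero_le_one.trans (hC e)
    rcases le_or_gt T 0 with hT0 | hT0
    · rw [pathsTo_eq_empty hl a e hT0, Set.ncard_empty, Nat.cast_zero]
      positivity
    have hone : 1 ≤ C * u e * Real.exp (h * T) :=
      one_le_mul_of_one_le_of_one_le (hC e) (Real.one_le_exp (by positivity))
    push_cast at hT
    calc ((pathsTo l a e T).ncard : ℝ)
        ≤ 1 + ∑ e' ∈ Finset.univ.filter (G.Adj e), ((pathsTo l a e' (T - l e.1)).ncard : ℝ) :=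
          mod_cast ncard_pathsTo_le hl a e T
      _ ≤ C * u e * Real.exp (h * T) + ∑ e' ∈ Finset.univ.filter (G.Adj e),
          n * (C * u e' * Real.exp (h * (T - l e.1))) :=
          add_le_add hone (Finset.sum_le_sum fun e' _ => ih e' (by linarith [hδ e.1]))
      _ = (n + 1 : ℕ) * (C * u e * Real.exp (h * T)) := by
          simp only [mul_assoc C, ← Finset.mul_sum, sum_adj_exp_mul hu]
          push_cast
          ring

variable (hupos : ∀ e, 0 < u e)
include hupos

theorem exists_ncard_pathsTo_le (a : G.DEdge) :
    ∃ C, ∀ e T, 1 ≤ T → ((pathsTo l a e T).ncard : ℝ) ≤ C * T * Real.exp (h * T) := by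
  obtain ⟨δ, hδ, hle⟩ := exists_pos_le hl
  obtain ⟨C, hC⟩ := exists_forall_le fun e => 1 / u e
  obtain ⟨K, hK⟩ := exists_forall_le fun e => C * u e
  have hCu (e : G.DEdge) : 1 ≤ C * u e := (div_le_iff₀ (hupos e)).1 (hC e)
  refine ⟨(1 / δ + 1) * K, fun e T hT => ?_⟩
  have hsteps : (⌈T / δ⌉₊ : ℝ) ≤ (1 / δ + 1) * T :=
    calc (⌈T / δ⌉₊ : ℝ) ≤ T / δ + 1 := (Nat.ceil_lt_add_one (by positivity)).le
      _ ≤ (1 / δ + 1) * T := by rw [add_mul, one_div_mul_eq_div, one_mul]; gcongr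
  calc ((pathsTo l a e T).ncard : ℝ) ≤ ⌈T / δ⌉₊ * (C * u e * Real.exp (h * T)) :=
        ncard_pathsTo_le_exp hl hh hu hle hCu a _ e ((div_le_iff₀ hδ).1 (Nat.le_ceil _))
    _ ≤ (1 / δ + 1) * T * (K * Real.exp (h * T)) := by
        have := zero_le_one.trans (hCu e)
        gcongr
        exact hK e
    _ = (1 / δ + 1) * K * T * Real.exp (h * T) := by ring

theorem le_ncard_pathsTo {δ L M c : ℝ} (hδ : ∀ e, δ ≤ l e) (hL : ∀ e, l e ≤ L) {a : G.DEdge}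
    (hM : ∀ e T, M < T → 1 ≤ (pathsTo l a e T).ncard) (hc0 : 0 ≤ c)
    (hc : ∀ e, c * u e * Real.exp (h * (M + L)) ≤ 1)
    (n : ℕ) (e : G.DEdge) {T : ℝ} (hMT : M < T) (hT : T ≤ M + L + n * δ) :
    c * u e * Real.exp (h * T) ≤ ((pathsTo l a e T).ncard : ℝ) := by
  have hshort (e : G.DEdge) {T : ℝ} (hMT : M < T) (hT : T ≤ M + L) :
      c * u e * Real.exp (h * T) ≤ ((pathsTo l a e T).ncard : ℝ) := by
    have hcu : 0 ≤ c * u e := mul_nonneg hc0 (hupos e).le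
    calc c * u e * Real.exp (h * T) ≤ c * u e * Real.exp (h * (M + L)) := by gcongr
      _ ≤ 1 := hc e
      _ ≤ ((pathsTo l a e T).ncard : ℝ) := mod_cast hM e T hMT
  induction n generalizing e T with
  | zero => exact hshort e hMT (by simpa using hT)
  | succ n ih =>
    rcases le_or_gt T (M + L) with hTL | hTL
    · exact hshort e hMT hTL
    push_cast at hT
    calc c * u e * Real.exp (h * T)
        = ∑ e' ∈ Finset.univ.filter (G.Adj e), c * u e' * Real.exp (h * (T - l e.1)) := by
          simp only [mul_assoc c, ← Finset.mul_sum, sum_adj_exp_mul hu]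
      _ ≤ ∑ e' ∈ Finset.univ.filter (G.Adj e), ((pathsTo l a e' (T - l e.1)).ncard : ℝ) :=
          Finset.sum_le_sum fun e' _ =>
            ih e' (by linarith [hL e.1]) (by linarith [hδ e.1])
      _ ≤ ((pathsTo l a e T).ncard : ℝ) := mod_cast sum_ncard_pathsTo_le hl a e T

theorem exists_le_ncard_pathsTo (hG : G.Irreducible) (a : G.DEdge) :
    ∃ c > 0, ∀ᶠ T in atTop, c * Real.exp (h * T) ≤ ((pathsTo l a a T).ncard : ℝ) := by
  obtain ⟨δ, hδ, hle⟩ := exists_pos_le hl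
  obtain ⟨L, hL⟩ := exists_forall_le l
  obtain ⟨M, hM⟩ := exists_one_le_ncard_pathsTo hl hG a
  obtain ⟨K, hK⟩ := exists_forall_le fun e => u e * Real.exp (h * (M + L))
  have hKpos : 0 < K := lt_of_lt_of_le (mul_pos (hupos a) (Real.exp_pos _)) (hK a)
  refine ⟨K⁻¹ * u a, mul_pos (inv_pos.2 hKpos) (hupos a), ?_⟩
  filter_upwards [eventually_gt_atTop M] with T hT
  obtain ⟨n, hn⟩ := exists_nat_ge ((T - (M + L)) / δ)
  refine le_ncard_pathsTo hl hh hu hupos hle hL hM (inv_nonneg.2 hKpos.le) (fun e => ?_) n a hT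
    (by linarith [(div_le_iff₀ hδ).1 hn])
  rw [mul_assoc]
  exact inv_mul_le_one_of_le₀ (hK e) hKpos.le

end Eigenvector

/-- The entropy of `l` is the `h` for which the pressure of `-h l` vanishes. -/
theorem hasEntropy_of_perron [Nonempty G.DEdge] (hl : ∀ e, 0 < l e) {h : ℝ} (hh : 0 < h)
    (P : Perron (h • l)) (hG : G.Irreducible) : G.HasEntropy l h := by
  obtain ⟨a⟩ := ‹Nonempty G.DEdge›
  obtain ⟨c, hc, hlow⟩ := exists_le_ncard_pathsTo hl hh.le P.right_eq P.right_pos hG a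
  choose C hC using exists_ncard_pathsTo_le hl hh.le P.right_eq P.right_pos
  refine tendsto_log_div_of_exp_bounds (C := ∑ b, C b) hh hc ?_ ?_
  · filter_upwards [hlow] with T hT
    have hcard : ((pathsTo l a a T).ncard : ℝ) ≤ (G.cyclesBelow l T).ncard + 1 :=
      mod_cast ncard_pathsTo_self_le hl a T
    linarith
  · filter_upwards [eventually_ge_atTop 1] with T hT
    calc ((G.cyclesBelow l T).ncard : ℝ) ≤ ∑ b, ((pathsTo l b b T).ncard : ℝ) :=
          mod_cast ncard_cyclesBelow_le hl T
      _ ≤ (∑ b, C b) * T * Real.exp (h * T) := by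
          rw [Finset.sum_mul, Finset.sum_mul]
          exact Finset.sum_le_sum fun b _ => hC b b T hT

end FinGraph

/-! ### Curvature of diagonal metrics -/

section DiagonalMetric

variable {p : Fin 2 → ℝ}

theorem partialD_congr {F : Type*} [NormedAddCommGroup F] [NormedSpace ℝ F]
    {f g : (Fin 2 → ℝ) → F} (h : f =ᶠ[𝓝 p] g) (i : Fin 2) : partialD i f p = partialD i g p :=
  h.lineDeriv_eq

theorem partialD_const (c : ℝ) (i : Fin 2) : partialD i (fun _ : Fin 2 → ℝ => c) p = 0 :=
  deriv_const 0 c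

theorem partialD_eq_fderiv {f : (Fin 2 → ℝ) → ℝ} (hf : DifferentiableAt ℝ f p) (i : Fin 2) :
    partialD i f p = fderiv ℝ f p (Pi.single i 1) :=
  hf.lineDeriv_eq_fderiv

theorem differentiableAt_partialD {f : (Fin 2 → ℝ) → ℝ} (hf : ContDiffAt ℝ 2 f p)
    (i : Fin 2) : DifferentiableAt ℝ (partialD i f) p := by
  have hfderiv : DifferentiableAt ℝ (fderiv ℝ f) p :=
    (hf.fderiv_right (m := 1) (by norm_num)).differentiableAt one_ne_zero
  refine (hfderiv.clm_apply (differentiableAt_const (Pi.single i (1 : ℝ)))).congr_of_eventuallyEq ?_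
  filter_upwards [hf.eventually (by norm_num)] with q hq
  exact partialD_eq_fderiv (hq.differentiableAt two_ne_zero) i

theorem hasDerivAt_partialD {f : (Fin 2 → ℝ) → ℝ} (hf : DifferentiableAt ℝ f p) (i : Fin 2) :
    HasDerivAt (fun t : ℝ => f (p + t • Pi.single i 1)) (partialD i f p) 0 :=
  hf.lineDifferentiableAt.hasLineDerivAt

theorem partialD_mul {f g : (Fin 2 → ℝ) → ℝ} (hf : DifferentiableAt ℝ f p)
    (hg : DifferentiableAt ℝ g p) (i : Fin 2) :
    partialD i (fun q => f q * g q) p = partialD i f p * g p + f p * partialD i g p := by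
  refine ((hasDerivAt_partialD hf i).fun_mul (hasDerivAt_partialD hg i)).deriv.trans ?_
  simp only [zero_smul, add_zero]

theorem partialD_const_mul_div {f g : (Fin 2 → ℝ) → ℝ} (hf : DifferentiableAt ℝ f p)
    (hg : DifferentiableAt ℝ g p) (h0 : g p ≠ 0) (c : ℝ) (i : Fin 2) :
    partialD i (fun q => c * (f q / g q)) p =
      c * ((partialD i f p * g p - f p * partialD i g p) / g p ^ 2) := by
  refine (((hasDerivAt_partialD hf i).fun_div (hasDerivAt_partialD hg i)
    (by simpa using h0)).const_mul c).deriv.trans ?_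
  simp only [zero_smul, add_zero]

variable {g : (Fin 2 → ℝ) → Matrix (Fin 2) (Fin 2) ℝ} {E G : (Fin 2 → ℝ) → ℝ}

theorem christoffel_diagonal (hg : g =ᶠ[𝓝 p] fun q => !![E q, 0; 0, G q]) (hE : E p ≠ 0)
    (hG : G p ≠ 0) (k i j : Fin 2) :
    christoffel g k i j p =
      (![!![partialD 0 E p, partialD 1 E p; partialD 1 E p, -partialD 0 G p] i j / (2 * E p),
        !![-partialD 1 E p, partialD 0 G p; partialD 0 G p, partialD 1 G p] i j / (2 * G p)] :
        Fin 2 → ℝ) k := by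
  have hpartial (i j m : Fin 2) : partialD m (fun q => g q i j) p =
      partialD m (fun q => !![E q, 0; 0, G q] i j) p :=
    partialD_congr (hg.mono fun q hq => congrArg (fun A => A i j) hq) m
  have hinv : (g p)⁻¹ = !![(E p)⁻¹, 0; 0, (G p)⁻¹] := by
    rw [hg.self_of_nhds]
    exact Matrix.inv_eq_right_inv (by simp [hE, hG, Matrix.one_fin_two])
  simp only [christoffel, hinv, Fin.sum_univ_two, hpartial]
  fin_cases k <;> fin_cases i <;> fin_cases j <;>
    simp only [Fin.zero_eta, Fin.mk_one, Matrix.of_apply, Matrix.cons_val',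
      Matrix.cons_val_zero, Matrix.cons_val_one, Matrix.cons_val_fin_one,
      partialD_const, zero_mul, add_zero, zero_add, add_sub_cancel_right, sub_zero] <;>
    field_simp <;> ring

theorem gaussCurvature_diagonal (hg : g =ᶠ[𝓝 p] fun q => !![E q, 0; 0, G q])
    (hE : ContDiffAt ℝ 2 E p) (hG : ContDiffAt ℝ 2 G p) (hE0 : E p ≠ 0) (hG0 : G p ≠ 0) :
    gaussCurvature g p =
      (E p * (partialD 1 E p * partialD 1 G p + partialD 0 G p ^ 2) +
        G p * (partialD 0 E p * partialD 0 G p + partialD 1 E p ^ 2)) / (4 * E p ^ 2 * G p ^ 2) -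
      (partialD 1 (partialD 1 E) p + partialD 0 (partialD 0 G) p) / (2 * E p * G p) := by
  have hchr : ∀ᶠ q in 𝓝 p, ∀ k i j : Fin 2, christoffel g k i j q =
      (![!![partialD 0 E q, partialD 1 E q; partialD 1 E q, -partialD 0 G q] i j / (2 * E q),
        !![-partialD 1 E q, partialD 0 G q; partialD 0 G q, partialD 1 G q] i j / (2 * G q)] :
        Fin 2 → ℝ) k := by
    filter_upwards [hg.eventuallyEq_nhds, hE.continuousAt.eventually_ne hE0,
      hG.continuousAt.eventually_ne hG0] with q hq hEq hGq
    exact christoffel_diagonal hq hEq hGq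
  have hEd := hE.differentiableAt two_ne_zero
  have hderiv_left : partialD 0 (christoffel g 0 1 1) p = -1 / 2 *
      ((partialD 0 (partialD 0 G) p * E p - partialD 0 G p * partialD 0 E p) / E p ^ 2) := by
    rw [← partialD_const_mul_div (differentiableAt_partialD hG 0) hEd hE0]
    refine partialD_congr (hchr.mono fun q hq => (hq 0 1 1).trans ?_) 0
    simp only [Matrix.of_apply, Matrix.cons_val', Matrix.cons_val_zero,
      Matrix.cons_val_one, Matrix.cons_val_fin_one]
    ring
  have hderiv_right : partialD 1 (christoffel g 0 0 1) p = 1 / 2 *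
      ((partialD 1 (partialD 1 E) p * E p - partialD 1 E p * partialD 1 E p) / E p ^ 2) := by
    rw [← partialD_const_mul_div (differentiableAt_partialD hE 1) hEd hE0]
    refine partialD_congr (hchr.mono fun q hq => (hq 0 0 1).trans ?_) 1
    simp only [Matrix.of_apply, Matrix.cons_val', Matrix.cons_val_zero,
      Matrix.cons_val_one, Matrix.cons_val_fin_one]
    ring
  simp only [gaussCurvature, curvatureTensor, Fin.sum_univ_two, hderiv_left, hderiv_right,
    hchr.self_of_nhds, hg.self_of_nhds, Matrix.det_fin_two_of,
    Matrix.of_apply, Matrix.cons_val', Matrix.cons_val_zero,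
    Matrix.cons_val_one, Matrix.cons_val_fin_one]
  field_simp
  ring

end DiagonalMetric

namespace Dumbbell

open FinGraph

/-! ### The entropy-one surface of the dumbbell -/

section Surface

theorem forall_edge {p : Fin dumbbell.numEdges → Prop} (h₁ : p (0 : Fin 3)) (h₂ : p (1 : Fin 3))
    (h₃ : p (2 : Fin 3)) : ∀ e, p e :=
  Fin.forall_fin_succ.2 ⟨h₁, Fin.forall_fin_two.2 ⟨h₂, h₃⟩⟩

theorem forall_dedge {p : dumbbell.DEdge → Prop} (h₁ : ∀ t, p ((0 : Fin 3), t))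
    (h₂ : ∀ t, p ((1 : Fin 3), t)) (h₃ : p ((2 : Fin 3), true)) (h₄ : p ((2 : Fin 3), false)) :
    ∀ e, p e := fun e =>
  forall_edge (p := fun i => ∀ t, p (i, t)) h₁ h₂ (Bool.forall_bool.2 ⟨h₄, h₃⟩) e.1 e.2

theorem sum_dedge (f : dumbbell.DEdge → ℝ) : ∑ e, f e =
    f ((0 : Fin 3), true) + f ((0 : Fin 3), false) + f ((1 : Fin 3), true) +
      f ((1 : Fin 3), false) + f ((2 : Fin 3), true) + f ((2 : Fin 3), false) := by
  have h : ∑ e, f e = ∑ i : Fin 3, ∑ b : Bool, f (i, b) := Fintype.sum_prod_type f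
  rw [h]
  simp only [Fin.sum_univ_three, Fintype.sum_bool]
  ring

instance : Nonempty dumbbell.DEdge := ⟨((0 : Fin 3), true)⟩

instance : Nonempty dumbbell.Path :=
  have h : dumbbell.Adj ((0 : Fin 3), true) ((0 : Fin 3), true) := by decide
  ⟨⟨fun _ => ((0 : Fin 3), true), fun _ => h⟩⟩

theorem irreducible : dumbbell.Irreducible := by
  have out₀ (t : Bool) : dumbbell.Adj ((0 : Fin 3), t) ((2 : Fin 3), true) := by
    revert t; decide
  have out₁ (t : Bool) : dumbbell.Adj ((1 : Fin 3), t) ((2 : Fin 3), false) := by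
    revert t; decide
  have in₀ (t : Bool) : dumbbell.Adj ((2 : Fin 3), false) ((0 : Fin 3), t) := by
    revert t; decide
  have in₁ (t : Bool) : dumbbell.Adj ((2 : Fin 3), true) ((1 : Fin 3), t) := by
    revert t; decide
  have cross : Relation.ReflTransGen dumbbell.Adj ((2 : Fin 3), true) ((2 : Fin 3), false) :=
    .head (in₁ true) (.single (out₁ true))
  have cross_rev : Relation.ReflTransGen dumbbell.Adj ((2 : Fin 3), false) ((2 : Fin 3), true) :=
    .head (in₀ true) (.single (out₀ true))
  have to_bridge : ∀ e, Relation.ReflTransGen dumbbell.Adj e ((2 : Fin 3), true) :=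
    forall_dedge (fun t => .single (out₀ t)) (fun t => .head (out₁ t) cross_rev) .refl cross_rev
  have from_bridge : ∀ e, Relation.ReflTransGen dumbbell.Adj ((2 : Fin 3), true) e :=
    forall_dedge (fun t => cross.tail (in₀ t)) (fun t => .single (in₁ t)) .refl cross
  exact fun e f => (to_bridge e).trans (from_bridge f)

/-- The function of directed edges that takes the values `a`, `b` on the loops and `c`, `c'` on the
two directions of the bridge. -/
def edgeFn (a b c c' : ℝ) (e : dumbbell.DEdge) : ℝ :=
  (![fun _ => a, fun _ => b, fun t => if t then c else c'] : Fin 3 → Bool → ℝ) e.1 e.2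

variable {a b c c' : ℝ}

theorem edgeFn_loop_left (t : Bool) : edgeFn a b c c' ((0 : Fin 3), t) = a := rfl

theorem edgeFn_loop_right (t : Bool) : edgeFn a b c c' ((1 : Fin 3), t) = b := rfl

theorem edgeFn_bridge : edgeFn a b c c' ((2 : Fin 3), true) = c := rfl

theorem edgeFn_bridge_rev : edgeFn a b c c' ((2 : Fin 3), false) = c' := rfl

theorem edgeFn_pos (ha : 0 < a) (hb : 0 < b) (hc : 0 < c) (hc' : 0 < c') :
    ∀ e, 0 < edgeFn a b c c' e :=
  forall_dedge (fun _ => ha) (fun _ => hb) hc hc'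

theorem edgeFn_mul (a b c c' a₁ b₁ c₁ c₁' : ℝ) :
    ∀ e, edgeFn a b c c' e * edgeFn a₁ b₁ c₁ c₁' e =
      edgeFn (a * a₁) (b * b₁) (c * c₁) (c' * c₁') e :=
  forall_dedge (fun _ => rfl) (fun _ => rfl) rfl rfl

theorem sum_edgeFn (a b c c' : ℝ) : ∑ e, edgeFn a b c c' e = 2 * a + 2 * b + c + c' := by
  simp only [sum_dedge, edgeFn_loop_left, edgeFn_loop_right, edgeFn_bridge, edgeFn_bridge_rev]
  ring

theorem sum_weight_mul_edgeFn (l : dumbbell.EdgeFun) (a b c c' : ℝ) (e : dumbbell.DEdge) :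
    ∑ e', weight l e e' * edgeFn a b c c' e' =
      edgeFn (Real.exp (-l (0 : Fin 3)) * (a + c)) (Real.exp (-l (1 : Fin 3)) * (b + c'))
        (Real.exp (-l (2 : Fin 3)) * (2 * b)) (Real.exp (-l (2 : Fin 3)) * (2 * a)) e := by
  rw [sum_dedge]
  revert e
  refine forall_dedge (fun t => ?_) (fun t => ?_) ?_ ?_ <;> (try cases t) <;>
    simp +decide only [weight, if_true, if_false, edgeFn_loop_left, edgeFn_loop_right,
      edgeFn_bridge, edgeFn_bridge_rev] <;> ring

theorem sum_weight_transpose_mul_edgeFn (l : dumbbell.EdgeFun) (a b c c' : ℝ)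
    (e' : dumbbell.DEdge) :
    ∑ e, weight l e e' * edgeFn a b c c' e =
      edgeFn (Real.exp (-l (0 : Fin 3)) * a + Real.exp (-l (2 : Fin 3)) * c')
        (Real.exp (-l (1 : Fin 3)) * b + Real.exp (-l (2 : Fin 3)) * c)
        (Real.exp (-l (0 : Fin 3)) * (2 * a)) (Real.exp (-l (1 : Fin 3)) * (2 * b)) e' := by
  rw [sum_dedge]
  revert e'
  refine forall_dedge (fun t => ?_) (fun t => ?_) ?_ ?_ <;> (try cases t) <;>
    simp +decide only [weight, if_true, if_false, edgeFn_loop_left, edgeFn_loop_right,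
      edgeFn_bridge, edgeFn_bridge_rev] <;> ring

theorem exp_sub_one_pos {r : ℝ} (hr : 0 < r) : 0 < Real.exp r - 1 :=
  sub_pos.2 (Real.one_lt_exp_iff.2 hr)

/-- The expected number of further turns round a loop of length `r` that the reversed Markov chain
of the equilibrium state makes once it is on the loop. The number of turns is geometrically
distributed, with variance `turns r * (1 + turns r)`. -/
def turns (r : ℝ) : ℝ := 1 / (Real.exp r - 1)

theorem turns_pos {r : ℝ} (hr : 0 < r) : 0 < turns r :=
  one_div_pos.2 (exp_sub_one_pos hr)

theorem exp_neg_eq_turns {r : ℝ} (hr : 0 < r) : Real.exp (-r) = turns r / (1 + turns r) := by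
  have h := exp_sub_one_pos hr
  rw [Real.exp_neg, turns]
  field_simp
  ring

/-- The equation of the entropy-one moduli space of the dumbbell. -/
structure OnSurface (l : dumbbell.EdgeFun) : Prop where
  pos_left : 0 < l (0 : Fin 3)
  pos_right : 0 < l (1 : Fin 3)
  eq : (Real.exp (l (0 : Fin 3)) - 1) * (Real.exp (l (1 : Fin 3)) - 1) *
    Real.exp (l (2 : Fin 3)) ^ 2 = 4

variable {l : dumbbell.EdgeFun}

theorem OnSurface.turns_mul_turns (hl : OnSurface l) :
    4 * turns (l (0 : Fin 3)) * turns (l (1 : Fin 3)) * Real.exp (-l (2 : Fin 3)) ^ 2 = 1 := by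
  have hx := exp_sub_one_pos hl.pos_left
  have hy := exp_sub_one_pos hl.pos_right
  rw [turns, turns, Real.exp_neg]
  field_simp
  exact hl.eq.symm

/-- The eigenvectors of the weighted adjacency matrix of the dumbbell. -/
def perron (hl : OnSurface l) : Perron l where
  left := edgeFn (1 + turns (l (0 : Fin 3)))
    (2 * Real.exp (-l (2 : Fin 3)) * turns (l (0 : Fin 3)) * (1 + turns (l (1 : Fin 3))))
    (2 * turns (l (0 : Fin 3)))
    (4 * Real.exp (-l (2 : Fin 3)) * turns (l (0 : Fin 3)) * turns (l (1 : Fin 3)))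
  right := edgeFn 1 (2 * Real.exp (-l (2 : Fin 3)) * turns (l (1 : Fin 3)))
    (4 * Real.exp (-l (2 : Fin 3)) ^ 2 * turns (l (1 : Fin 3))) (2 * Real.exp (-l (2 : Fin 3)))
  left_pos := by
    have hs := turns_pos hl.pos_left
    have ht := turns_pos hl.pos_right
    apply edgeFn_pos <;> positivity
  right_pos := by
    have ht := turns_pos hl.pos_right
    apply edgeFn_pos <;> positivity
  left_eq e' := by
    have hs := turns_pos hl.pos_left
    have ht := turns_pos hl.pos_right
    have h := hl.turns_mul_turns
    rw [sum_weight_transpose_mul_edgeFn, exp_neg_eq_turns hl.pos_left,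
      exp_neg_eq_turns hl.pos_right]
    congr 1 <;> field_simp
    · linear_combination h
    · ring
    · norm_num
  right_eq e := by
    have hs := turns_pos hl.pos_left
    have ht := turns_pos hl.pos_right
    have h := hl.turns_mul_turns
    rw [sum_weight_mul_edgeFn, exp_neg_eq_turns hl.pos_left, exp_neg_eq_turns hl.pos_right]
    congr 1 <;> field_simp
    · linear_combination h
    · ring
    · norm_num

end Surface

/-! ### The pressure norm of the dumbbell -/

section PressureNorm

variable {l : dumbbell.EdgeFun}

theorem hasEntropy (hl : ∀ e, 0 < l e) {h : ℝ} (hh : 0 < h) (hs : OnSurface (h • l)) :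
    dumbbell.HasEntropy l h :=
  hasEntropy_of_perron hl hh (perron hs) irreducible

theorem exists_onSurface (hl : ∀ e, 0 < l e) : ∃ h : ℝ, 0 < h ∧ OnSurface (h • l) := by
  have hx := hl (0 : Fin 3)
  have hy := hl (1 : Fin 3)
  have hz := hl (2 : Fin 3)
  let f (h : ℝ) : ℝ := (Real.exp (h * l (0 : Fin 3)) - 1) *
    (Real.exp (h * l (1 : Fin 3)) - 1) * Real.exp (h * l (2 : Fin 3)) ^ 2
  have hcont : Continuous f := by fun_prop
  have hzero : f 0 < 4 := by simp [f]
  have htop : Tendsto f atTop atTop := by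
    have loop {r : ℝ} (hr : 0 < r) : Tendsto (fun h => Real.exp (h * r) - 1) atTop atTop :=
      tendsto_atTop_add_const_right _ _
        (Real.tendsto_exp_atTop.comp (tendsto_id.atTop_mul_const hr))
    refine ((loop hx).atTop_mul_atTop₀ (loop hy)).atTop_mul_atTop₀ ?_
    exact (tendsto_pow_atTop two_ne_zero).comp
      (Real.tendsto_exp_atTop.comp (tendsto_id.atTop_mul_const hz))
  obtain ⟨k, hk, hfk⟩ := ((eventually_ge_atTop 0).and (htop.eventually_ge_atTop 4)).exists
  obtain ⟨h, hh, hfh⟩ := intermediate_value_Icc hk hcont.continuousOn ⟨hzero.le, hfk⟩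
  have hpos : 0 < h := hh.1.lt_of_ne fun h0 => hzero.ne (h0 ▸ hfh)
  exact ⟨h, hpos, mul_pos hpos hx, mul_pos hpos hy, hfh⟩

theorem mem_moduliOne_iff : l ∈ dumbbell.moduliOne ↔ OnSurface l ∧ 0 < l (2 : Fin 3) := by
  constructor
  · rintro ⟨hl, h1⟩
    obtain ⟨h, hpos, hs⟩ := exists_onSurface hl
    obtain rfl := tendsto_nhds_unique (hasEntropy hl hpos hs) h1
    exact ⟨one_smul ℝ l ▸ hs, hl (2 : Fin 3)⟩
  · rintro ⟨hs, hz⟩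
    have hl : ∀ e, 0 < l e := forall_edge hs.pos_left hs.pos_right hz
    exact ⟨hl, hasEntropy hl one_pos ((one_smul ℝ l).symm ▸ hs)⟩

theorem exp_chart_bridge_sq {p : Fin 2 → ℝ} (hx : 0 < p 0) (hy : 0 < p 1) :
    Real.exp (dumbbellChart p (2 : Fin 3)) ^ 2 =
      4 / ((Real.exp (p 0) - 1) * (Real.exp (p 1) - 1)) := by
  have h0 : 0 < (Real.exp (p 0) - 1) * (Real.exp (p 1) - 1) :=
    mul_pos (exp_sub_one_pos hx) (exp_sub_one_pos hy)
  have hbridge : (2 : ℕ) * dumbbellChart p (2 : Fin 3) = Real.log 2 + Real.log 2 -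
      Real.log ((Real.exp (p 0) - 1) * (Real.exp (p 1) - 1)) := by
    simp only [dumbbellChart, Matrix.cons_val]
    push_cast
    ring
  rw [← Real.exp_nat_mul, hbridge, Real.exp_sub, Real.exp_add, Real.exp_log two_pos,
    Real.exp_log h0]
  norm_num

theorem onSurface_chart {p : Fin 2 → ℝ} (hx : 0 < p 0) (hy : 0 < p 1) :
    OnSurface (dumbbellChart p) where
  pos_left := hx
  pos_right := hy
  eq := by
    have h0 : 0 < (Real.exp (p 0) - 1) * (Real.exp (p 1) - 1) :=
      mul_pos (exp_sub_one_pos hx) (exp_sub_one_pos hy)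
    rw [exp_chart_bridge_sq hx hy]
    exact mul_div_cancel₀ 4 h0.ne'

theorem OnSurface.eq_chart (hl : OnSurface l) :
    l = dumbbellChart ![l (0 : Fin 3), l (1 : Fin 3)] := by
  have h := exp_chart_bridge_sq (p := ![l (0 : Fin 3), l (1 : Fin 3)]) hl.pos_left hl.pos_right
  have hbridge : l (2 : Fin 3) = dumbbellChart ![l (0 : Fin 3), l (1 : Fin 3)] (2 : Fin 3) := by
    have hx := exp_sub_one_pos hl.pos_left
    have hy := exp_sub_one_pos hl.pos_right
    refine Real.exp_injective ((sq_eq_sq₀ (Real.exp_pos _).le (Real.exp_pos _).le).1 ?_)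
    rw [h]
    exact eq_div_of_mul_eq (mul_pos hx hy).ne' ((mul_comm _ _).trans hl.eq)
  exact funext (forall_edge rfl rfl hbridge)

theorem chart_bridge_pos_iff {p : Fin 2 → ℝ} (hx : 0 < p 0) (hy : 0 < p 1) :
    0 < dumbbellChart p (2 : Fin 3) ↔ (Real.exp (p 0) - 1) * (Real.exp (p 1) - 1) < 4 := by
  have h0 : 0 < (Real.exp (p 0) - 1) * (Real.exp (p 1) - 1) :=
    mul_pos (exp_sub_one_pos hx) (exp_sub_one_pos hy)
  rw [← one_lt_div h0, ← exp_chart_bridge_sq hx hy,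
    one_lt_sq_iff₀ (Real.exp_pos _).le, Real.one_lt_exp_iff]

theorem chart_mem_moduliOne_iff {p : Fin 2 → ℝ} (hx : 0 < p 0) (hy : 0 < p 1) :
    dumbbellChart p ∈ dumbbell.moduliOne ↔
      (Real.exp (p 0) - 1) * (Real.exp (p 1) - 1) < 4 := by
  rw [mem_moduliOne_iff, chart_bridge_pos_iff hx hy, and_iff_right (onSurface_chart hx hy)]

theorem moduliOne_eq : dumbbell.moduliOne = dumbbellChart '' dumbbellDomain := by
  refine Set.Subset.antisymm (fun l hl => ?_) ?_
  · have hs := (mem_moduliOne_iff.1 hl).1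
    rw [hs.eq_chart] at hl
    exact ⟨_, ⟨hs.pos_left, hs.pos_right,
      (chart_mem_moduliOne_iff hs.pos_left hs.pos_right).1 hl⟩, hs.eq_chart.symm⟩
  · rintro _ ⟨p, ⟨hx, hy, hp⟩, rfl⟩
    exact (chart_mem_moduliOne_iff hx hy).2 hp

end PressureNorm

section Irreducible

variable {l : dumbbell.EdgeFun}

/-- The mass of each direction of the bridge for the equilibrium state of a point of the surface
whose loops have lengths `x` and `y`. -/
def bridgeMass (x y : ℝ) : ℝ := 1 / (4 + turns x + turns y)

theorem bridgeMass_pos {x y : ℝ} (hx : 0 < x) (hy : 0 < y) : 0 < bridgeMass x y := by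
  have hs := turns_pos hx
  have ht := turns_pos hy
  rw [bridgeMass]
  positivity

theorem perron_left_mul_right (hl : OnSurface l) (e : dumbbell.DEdge) :
    (perron hl).left e * (perron hl).right e =
      edgeFn (1 + turns (l (0 : Fin 3))) (1 + turns (l (1 : Fin 3))) 2 2 e := by
  have h := hl.turns_mul_turns
  rw [perron, edgeFn_mul]
  congr 1
  · ring
  · linear_combination (1 + turns (l (1 : Fin 3))) * h
  · linear_combination 2 * h
  · linear_combination 2 * h

theorem headProb_eqState (hl : OnSurface l) (e : dumbbell.DEdge) :
    headProb (eqState l) e = bridgeMass (l (0 : Fin 3)) (l (1 : Fin 3)) *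
      edgeFn ((1 + turns (l (0 : Fin 3))) / 2) ((1 + turns (l (1 : Fin 3))) / 2) 1 1 e := by
  rw [((perron hl).isInvariant_eqState irreducible).headProb_eq irreducible]
  simp only [perron_left_mul_right, sum_edgeFn]
  rw [div_eq_iff (by linarith [turns_pos hl.pos_left, turns_pos hl.pos_right]), bridgeMass]
  have hs := turns_pos hl.pos_left
  have ht := turns_pos hl.pos_right
  revert e
  refine forall_dedge (fun t => ?_) (fun t => ?_) ?_ ?_ <;>
    simp only [edgeFn_loop_left, edgeFn_loop_right, edgeFn_bridge, edgeFn_bridge_rev] <;>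
    field_simp <;> ring

theorem condMean_edgeFn (hl : OnSurface l) (a b c c' : ℝ) (e' : dumbbell.DEdge) :
    (perron hl).condMean (edgeFn a b c c') e' =
      edgeFn ((turns (l (0 : Fin 3)) * a + c') / (1 + turns (l (0 : Fin 3))))
        ((turns (l (1 : Fin 3)) * b + c) / (1 + turns (l (1 : Fin 3)))) a b e' := by
  have hs := turns_pos hl.pos_left
  have ht := turns_pos hl.pos_right
  have h := hl.turns_mul_turns
  simp only [Perron.condMean, Perron.backward, div_mul_eq_mul_div, mul_assoc, ← Finset.sum_div]
  rw [div_eq_iff ((perron hl).left_pos e').ne']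
  simp only [perron, edgeFn_mul, sum_weight_transpose_mul_edgeFn,
    exp_neg_eq_turns hl.pos_left, exp_neg_eq_turns hl.pos_right]
  congr 1 <;> field_simp
  · linear_combination c' * h
  · ring

theorem condVar_edgeFn (hl : OnSurface l) (a b c c' : ℝ) (e' : dumbbell.DEdge) :
    ∑ e, (perron hl).backward e' e *
        (edgeFn a b c c' e - (perron hl).condMean (edgeFn a b c c') e') ^ 2 =
      edgeFn (turns (l (0 : Fin 3)) * ((a - c') / (1 + turns (l (0 : Fin 3)))) ^ 2)
        (turns (l (1 : Fin 3)) * ((b - c) / (1 + turns (l (1 : Fin 3)))) ^ 2) 0 0 e' := by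
  have hs := turns_pos hl.pos_left
  have ht := turns_pos hl.pos_right
  have hsq (m : ℝ) (e : dumbbell.DEdge) : (edgeFn a b c c' e - m) ^ 2 =
      edgeFn ((a - m) ^ 2) ((b - m) ^ 2) ((c - m) ^ 2) ((c' - m) ^ 2) e := by
    revert e
    exact forall_dedge (fun _ => rfl) (fun _ => rfl) rfl rfl
  simp only [hsq]
  change (perron hl).condMean (edgeFn _ _ _ _) e' = _
  simp only [condMean_edgeFn]
  revert e'
  refine forall_dedge (fun t => ?_) (fun t => ?_) ?_ ?_ <;>
    simp only [edgeFn_loop_left, edgeFn_loop_right, edgeFn_bridge, edgeFn_bridge_rev] <;>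
    field_simp <;> ring

/-- The integral of an edge function for the equilibrium state. -/
def meanValue (l φ : dumbbell.EdgeFun) : ℝ :=
  bridgeMass (l (0 : Fin 3)) (l (1 : Fin 3)) * ((1 + turns (l (0 : Fin 3))) * φ (0 : Fin 3) +
    (1 + turns (l (1 : Fin 3))) * φ (1 : Fin 3) + 2 * φ (2 : Fin 3))

/-- The variance of an edge function for the equilibrium state. Only the loops contribute, since
the predecessors of a direction of the bridge are the two directions of one loop, on which an edge
function agrees. -/
def variance (l φ : dumbbell.EdgeFun) : ℝ :=
  bridgeMass (l (0 : Fin 3)) (l (1 : Fin 3)) *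
    (turns (l (0 : Fin 3)) * (1 + turns (l (0 : Fin 3))) * (φ (0 : Fin 3) - meanValue l φ) ^ 2 +
      turns (l (1 : Fin 3)) * (1 + turns (l (1 : Fin 3))) * (φ (1 : Fin 3) - meanValue l φ) ^ 2)

theorem sum_sub_meanValue (hl : OnSurface l) (φ : dumbbell.EdgeFun) :
    (1 + turns (l (0 : Fin 3))) * (φ (0 : Fin 3) - meanValue l φ) +
      (1 + turns (l (1 : Fin 3))) * (φ (1 : Fin 3) - meanValue l φ) +
      2 * (φ (2 : Fin 3) - meanValue l φ) = 0 := by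
  have hs := turns_pos hl.pos_left
  have ht := turns_pos hl.pos_right
  simp only [meanValue, bridgeMass]
  field_simp
  ring

/-- A solution of Poisson's equation for the reversed chain. -/
def poisson (l φ : dumbbell.EdgeFun) : dumbbell.DEdge → ℝ :=
  let d := ((1 + turns (l (0 : Fin 3))) * (φ (0 : Fin 3) - meanValue l φ) -
    (1 + turns (l (1 : Fin 3))) * (φ (1 : Fin 3) - meanValue l φ)) / 4
  edgeFn d (-d) (φ (2 : Fin 3) - meanValue l φ + d) (φ (2 : Fin 3) - meanValue l φ - d)

theorem poisson_eq (hl : OnSurface l) (φ : dumbbell.EdgeFun) (e' : dumbbell.DEdge) :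
    poisson l φ e' = φ e'.1 - meanValue l φ + (perron hl).condMean (poisson l φ) e' := by
  have hs := turns_pos hl.pos_left
  have ht := turns_pos hl.pos_right
  have h := sum_sub_meanValue hl φ
  rw [poisson, condMean_edgeFn]
  revert e'
  refine forall_dedge (fun t => ?_) (fun t => ?_) ?_ ?_ <;>
    simp only [edgeFn_loop_left, edgeFn_loop_right, edgeFn_bridge, edgeFn_bridge_rev]
  · field_simp
    linear_combination (-2) * h
  · field_simp
    linear_combination (-2) * h
  · ring

theorem condVar_poisson (hl : OnSurface l) (φ : dumbbell.EdgeFun) (e' : dumbbell.DEdge) :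
    ∑ e, (perron hl).backward e' e *
        (poisson l φ e - (perron hl).condMean (poisson l φ) e') ^ 2 =
      edgeFn (turns (l (0 : Fin 3)) * (φ (0 : Fin 3) - meanValue l φ) ^ 2)
        (turns (l (1 : Fin 3)) * (φ (1 : Fin 3) - meanValue l φ) ^ 2) 0 0 e' := by
  have hs := turns_pos hl.pos_left
  have ht := turns_pos hl.pos_right
  have h := sum_sub_meanValue hl φ
  rw [poisson, condVar_edgeFn]
  congr 3 <;> field_simp <;> linear_combination (-2) * h

theorem tendsto_varianceSeq (hl : OnSurface l) (φ : dumbbell.EdgeFun) :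
    Tendsto (varianceSeq (onPath φ) (eqState l)) atTop (𝓝 (variance l φ)) := by
  convert ((perron hl).isInvariant_eqState irreducible).tendsto_varianceSeq (poisson_eq hl φ)
    using 2
  simp only [condVar_poisson, headProb_eqState hl, mul_assoc, edgeFn_mul, ← Finset.mul_sum,
    sum_edgeFn, variance]
  ring

theorem pressureSq_eq (hl : OnSurface l) (φ : dumbbell.EdgeFun) :
    pressureSq l φ = variance l φ :=
  (tendsto_varianceSeq hl φ).limUnder_eq

end Irreducible

/-! ### The first fundamental form and its curvature -/

section FundamentalForm

variable {l : dumbbell.EdgeFun}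

/-- The vector tangent to the surface at `l` whose components on the loops are `a` and `b`. -/
def tangentVec (l : dumbbell.EdgeFun) (a b : ℝ) : dumbbell.EdgeFun :=
  ![a, b, -(1 / 2) * ((1 + turns (l (0 : Fin 3))) * a + (1 + turns (l (1 : Fin 3))) * b)]

theorem tangentVec_add (l : dumbbell.EdgeFun) (a b a' b' : ℝ) :
    tangentVec l a b + tangentVec l a' b' = tangentVec l (a + a') (b + b') :=
  funext (forall_edge rfl rfl (by
    change tangentVec l a b (2 : Fin 3) + tangentVec l a' b' (2 : Fin 3) = _
    simp only [tangentVec, Matrix.cons_val]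
    ring))

theorem meanValue_tangentVec (l : dumbbell.EdgeFun) (a b : ℝ) :
    meanValue l (tangentVec l a b) = 0 := by
  simp only [meanValue, tangentVec, Matrix.cons_val]
  ring

/-- The coefficient of `dx²` in the pressure metric at a point of the surface whose loops have
lengths `x` and `y`; the coefficient of `dy²` is `metricCoeff y x`. -/
def metricCoeff (x y : ℝ) : ℝ := bridgeMass x y * (turns x * (1 + turns x))

theorem bridgeMass_comm (x y : ℝ) : bridgeMass x y = bridgeMass y x := by
  rw [bridgeMass, bridgeMass, add_right_comm]

theorem metricCoeff_pos {x y : ℝ} (hx : 0 < x) (hy : 0 < y) : 0 < metricCoeff x y := by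
  have hs := turns_pos hx
  have hk := bridgeMass_pos hx hy
  rw [metricCoeff]
  positivity

theorem pressureSq_tangentVec (hl : OnSurface l) (a b : ℝ) : pressureSq l (tangentVec l a b) =
    metricCoeff (l (0 : Fin 3)) (l (1 : Fin 3)) * a ^ 2 +
      metricCoeff (l (1 : Fin 3)) (l (0 : Fin 3)) * b ^ 2 := by
  rw [pressureSq_eq hl, variance, meanValue_tangentVec, metricCoeff, metricCoeff,
    bridgeMass_comm (l (1 : Fin 3))]
  simp only [tangentVec, Matrix.cons_val]
  ring

theorem pressureInner_tangentVec (hl : OnSurface l) (a b a' b' : ℝ) :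
    pressureInner l (tangentVec l a b) (tangentVec l a' b') =
      metricCoeff (l (0 : Fin 3)) (l (1 : Fin 3)) * (a * a') +
        metricCoeff (l (1 : Fin 3)) (l (0 : Fin 3)) * (b * b') := by
  simp only [pressureInner, tangentVec_add, pressureSq_tangentVec hl]
  ring

variable {x x' y' t : ℝ} {u v : ℝ → ℝ} {s : Set ℝ}

theorem hasDerivAt_turns (hx : 0 < x) : HasDerivAt turns (-(turns x * (1 + turns x))) x := by
  have h0 := (exp_sub_one_pos hx).ne'
  refine (((Real.hasDerivAt_exp x).sub_const 1).inv h0).congr_of_eventuallyEq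
    (.of_forall fun r => one_div _) |>.congr_deriv ?_
  rw [turns]
  field_simp
  ring

theorem hasDerivWithinAt_chart {q : ℝ → Fin 2 → ℝ} {q' : Fin 2 → ℝ}
    (hq : HasDerivWithinAt q q' s t) (hx : 0 < q t 0) (hy : 0 < q t 1) :
    HasDerivWithinAt (fun r => dumbbellChart (q r))
      (tangentVec (dumbbellChart (q t)) (q' 0) (q' 1)) s t := by
  have hcoord := hasDerivWithinAt_pi.1 hq
  have hbridge : HasDerivWithinAt (fun r => dumbbellChart (q r) (2 : Fin 3))
      (tangentVec (dumbbellChart (q t)) (q' 0) (q' 1) (2 : Fin 3)) s t := by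
    have hX := exp_sub_one_pos hx
    have hY := exp_sub_one_pos hy
    have hlog := (((hcoord 0).exp.sub_const 1).mul ((hcoord 1).exp.sub_const 1)).log
      (mul_pos hX hY).ne'
    refine ((hlog.const_mul (1 / 2)).const_sub (Real.log 2)).congr_deriv ?_
    simp only [Pi.mul_apply, tangentVec, dumbbellChart, Matrix.cons_val, turns]
    field_simp
    ring
  exact hasDerivWithinAt_pi.2 (forall_edge (hcoord 0) (hcoord 1) hbridge)

theorem hasDerivAt_line (p w : Fin 2 → ℝ) : HasDerivAt (fun r : ℝ => p + r • w) w 0 := by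
  simpa using ((hasDerivAt_id (0 : ℝ)).smul_const w).const_add p

theorem partialD_chart {p : Fin 2 → ℝ} (hx : 0 < p 0) (hy : 0 < p 1) (i : Fin 2) :
    partialD i dumbbellChart p =
      tangentVec (dumbbellChart p) ((Pi.single i 1 : Fin 2 → ℝ) 0)
        ((Pi.single i 1 : Fin 2 → ℝ) 1) := by
  have h := hasDerivWithinAt_chart (hasDerivAt_line p (Pi.single i 1)).hasDerivWithinAt
    (s := Set.univ) (by simpa) (by simpa)
  simp only [zero_smul, add_zero] at h
  exact (hasDerivWithinAt_univ.1 h).deriv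

theorem hasDerivWithinAt_bridgeMass (hu : HasDerivWithinAt u x' s t)
    (hv : HasDerivWithinAt v y' s t) (hx : 0 < u t) (hy : 0 < v t) :
    HasDerivWithinAt (fun r => bridgeMass (u r) (v r))
      (bridgeMass (u t) (v t) * (metricCoeff (u t) (v t) * x' + metricCoeff (v t) (u t) * y'))
      s t := by
  have hs := turns_pos hx
  have ht := turns_pos hy
  have hsum := (((hasDerivAt_turns hx).comp_hasDerivWithinAt t hu).const_add 4).add
    ((hasDerivAt_turns hy).comp_hasDerivWithinAt t hv)
  have hne : 4 + turns (u t) + turns (v t) ≠ 0 := by positivity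
  refine ((hsum.inv hne).congr_of_eventuallyEq (.of_forall fun r => one_div _)
    (one_div _)).congr_deriv ?_
  simp only [Function.comp_apply, Pi.add_apply, metricCoeff, bridgeMass]
  field_simp
  ring

theorem hasDerivWithinAt_metricCoeff (hu : HasDerivWithinAt u x' s t)
    (hv : HasDerivWithinAt v y' s t) (hx : 0 < u t) (hy : 0 < v t) :
    HasDerivWithinAt (fun r => metricCoeff (u r) (v r))
      (metricCoeff (u t) (v t) * ((metricCoeff (u t) (v t) - 1 - 2 * turns (u t)) * x' +
        metricCoeff (v t) (u t) * y')) s t := by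
  have hs := (hasDerivAt_turns hx).comp_hasDerivWithinAt t hu
  refine ((hasDerivWithinAt_bridgeMass hu hv hx hy).mul (hs.mul (hs.const_add 1))).congr_deriv ?_
  simp only [Function.comp_apply, Pi.mul_apply]
  rw [metricCoeff.eq_1 (u t)]
  ring

end FundamentalForm

section Curvature

variable {p : Fin 2 → ℝ} {x y : ℝ}

theorem dumbbellForm_apply (hx : 0 < p 0) (hy : 0 < p 1) (i j : Fin 2) : dumbbellForm p i j =
    !![metricCoeff (p 0) (p 1), 0; 0, metricCoeff (p 1) (p 0)] i j := by
  change pressureInner _ (partialD i dumbbellChart p) (partialD j dumbbellChart p) = _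
  rw [partialD_chart hx hy, partialD_chart hx hy, pressureInner_tangentVec (onSurface_chart hx hy)]
  fin_cases i <;> fin_cases j <;> simp [dumbbellChart]

theorem contDiffAt_turns {n : WithTop ℕ∞} (hx : 0 < x) : ContDiffAt ℝ n turns x :=
  contDiffAt_const.div (Real.contDiff_exp.contDiffAt.sub contDiffAt_const)
    (exp_sub_one_pos hx).ne'

theorem contDiffAt_turns_apply {n : WithTop ℕ∞} {j : Fin 2} (hj : 0 < p j) :
    ContDiffAt ℝ n (fun q : Fin 2 → ℝ => turns (q j)) p :=
  ContDiffAt.comp (g := turns) p (contDiffAt_turns hj) (contDiff_apply ℝ ℝ j).contDiffAt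

theorem contDiffAt_bridgeMass {n : WithTop ℕ∞} {j k : Fin 2} (hj : 0 < p j) (hk : 0 < p k) :
    ContDiffAt ℝ n (fun q : Fin 2 → ℝ => bridgeMass (q j) (q k)) p := by
  have hs := turns_pos hj
  have ht := turns_pos hk
  exact contDiffAt_const.div ((contDiffAt_const.add (contDiffAt_turns_apply hj)).add
    (contDiffAt_turns_apply hk)) (by positivity)

theorem contDiffAt_metricCoeff {n : WithTop ℕ∞} {j k : Fin 2} (hj : 0 < p j) (hk : 0 < p k) :
    ContDiffAt ℝ n (fun q : Fin 2 → ℝ => metricCoeff (q j) (q k)) p :=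
  (contDiffAt_bridgeMass hj hk).mul
    ((contDiffAt_turns_apply hj).mul (contDiffAt_const.add (contDiffAt_turns_apply hj)))

theorem contDiffOn_form (i j : Fin 2) :
    ContDiffOn ℝ (⊤ : ℕ∞) (fun p => dumbbellForm p i j) dumbbellDomain := by
  refine ContDiffOn.congr (fun p hp => ContDiffAt.contDiffWithinAt ?_)
    fun p hp => dumbbellForm_apply hp.1 hp.2.1 i j
  fin_cases i <;> fin_cases j
  exacts [contDiffAt_metricCoeff hp.1 hp.2.1, contDiffAt_const, contDiffAt_const,
    contDiffAt_metricCoeff hp.2.1 hp.1]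

theorem partialD_metricCoeff {j k : Fin 2} (hj : 0 < p j) (hk : 0 < p k) (i : Fin 2) :
    partialD i (fun q => metricCoeff (q j) (q k)) p = metricCoeff (p j) (p k) *
      ((metricCoeff (p j) (p k) - 1 - 2 * turns (p j)) * (Pi.single i 1 : Fin 2 → ℝ) j +
        metricCoeff (p k) (p j) * (Pi.single i 1 : Fin 2 → ℝ) k) := by
  have hline := hasDerivAt_pi.1 (hasDerivAt_line p (Pi.single i 1))
  have h := hasDerivWithinAt_metricCoeff (s := Set.univ) (hline j).hasDerivWithinAt
    (hline k).hasDerivWithinAt (by simpa) (by simpa)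
  simp only [zero_smul, add_zero] at h
  exact (hasDerivWithinAt_univ.1 h).deriv

variable {j k : Fin 2}

theorem partialD_metricCoeff_self (hj : 0 < p j) (hk : 0 < p k) (hjk : j ≠ k) :
    partialD j (fun q => metricCoeff (q j) (q k)) p =
      metricCoeff (p j) (p k) * (metricCoeff (p j) (p k) - 1 - 2 * turns (p j)) := by
  simp [partialD_metricCoeff hj hk, hjk.symm]

theorem partialD_metricCoeff_of_ne (hj : 0 < p j) (hk : 0 < p k) (hjk : j ≠ k) :
    partialD k (fun q => metricCoeff (q j) (q k)) p =
      metricCoeff (p j) (p k) * metricCoeff (p k) (p j) := by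
  simp [partialD_metricCoeff hj hk, hjk]

theorem partialD_partialD_metricCoeff (hj : 0 < p j) (hk : 0 < p k) (hjk : j ≠ k) :
    partialD k (partialD k fun q => metricCoeff (q j) (q k)) p =
      metricCoeff (p j) (p k) * metricCoeff (p k) (p j) *
        (2 * metricCoeff (p k) (p j) - 1 - 2 * turns (p k)) := by
  have hpos : ∀ᶠ q : Fin 2 → ℝ in 𝓝 p, 0 < q j ∧ 0 < q k :=
    ((continuousAt_apply j p).eventually_const_lt hj).and
      ((continuousAt_apply k p).eventually_const_lt hk)
  rw [partialD_congr (hpos.mono fun q hq => partialD_metricCoeff_of_ne hq.1 hq.2 hjk),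
    partialD_mul ((contDiffAt_metricCoeff hj hk).differentiableAt one_ne_zero)
      ((contDiffAt_metricCoeff hk hj).differentiableAt one_ne_zero),
    partialD_metricCoeff_of_ne hj hk hjk, partialD_metricCoeff_self hk hj hjk.symm]
  ring

theorem gaussCurvature_form_eq_turns (hx : 0 < p 0) (hy : 0 < p 1) :
    gaussCurvature dumbbellForm p = (1 + turns (p 0) + turns (p 1) -
      metricCoeff (p 0) (p 1) - metricCoeff (p 1) (p 0)) / 2 := by
  have hform : dumbbellForm =ᶠ[𝓝 p] fun q =>
      !![metricCoeff (q 0) (q 1), 0; 0, metricCoeff (q 1) (q 0)] := by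
    filter_upwards [(continuousAt_apply 0 p).eventually_const_lt hx,
      (continuousAt_apply 1 p).eventually_const_lt hy] with q hq₀ hq₁
    exact Matrix.ext (dumbbellForm_apply hq₀ hq₁)
  have hE := (metricCoeff_pos hx hy).ne'
  have hG := (metricCoeff_pos hy hx).ne'
  rw [gaussCurvature_diagonal hform (contDiffAt_metricCoeff hx hy) (contDiffAt_metricCoeff hy hx)
      hE hG,
    partialD_metricCoeff_self hx hy zero_ne_one, partialD_metricCoeff_of_ne hx hy zero_ne_one,
    partialD_metricCoeff_self hy hx one_ne_zero, partialD_metricCoeff_of_ne hy hx one_ne_zero,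
    partialD_partialD_metricCoeff hx hy zero_ne_one,
    partialD_partialD_metricCoeff hy hx one_ne_zero]
  field_simp
  ring

theorem exp_eq_turns (x : ℝ) : Real.exp x = 1 + 1 / turns x := by
  rw [turns, one_div_one_div]
  ring

theorem denom_eq (hx : 0 < x) (hy : 0 < y) :
    4 * Real.exp (x + y) - 3 * Real.exp x - 3 * Real.exp y + 2 =
      1 / (bridgeMass x y * (turns x * turns y)) := by
  have hs := turns_pos hx
  have ht := turns_pos hy
  rw [Real.exp_add, exp_eq_turns x, exp_eq_turns y, bridgeMass]
  field_simp
  ring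

theorem denom_pos (hx : 0 < x) (hy : 0 < y) :
    0 < 4 * Real.exp (x + y) - 3 * Real.exp x - 3 * Real.exp y + 2 := by
  rw [denom_eq hx hy]
  exact one_div_pos.2
    (mul_pos (bridgeMass_pos hx hy) (mul_pos (turns_pos hx) (turns_pos hy)))

theorem gaussCurvature_form (hx : 0 < p 0) (hy : 0 < p 1) : gaussCurvature dumbbellForm p =
    (2 * Real.exp (p 0 + p 1) - 1) /
      (4 * Real.exp (p 0 + p 1) - 3 * Real.exp (p 0) - 3 * Real.exp (p 1) + 2) := by
  have hs := turns_pos hx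
  have ht := turns_pos hy
  rw [gaussCurvature_form_eq_turns hx hy, denom_eq hx hy, Real.exp_add, exp_eq_turns (p 0),
    exp_eq_turns (p 1), metricCoeff, metricCoeff, bridgeMass_comm (p 1), bridgeMass]
  field_simp
  ring

theorem half_le_gaussCurvature (hx : 0 < p 0) (hy : 0 < p 1) :
    1 / 2 ≤ gaussCurvature dumbbellForm p := by
  rw [gaussCurvature_form hx hy, div_le_div_iff₀ two_pos (denom_pos hx hy)]
  linarith [Real.one_lt_exp_iff.2 hx, Real.one_lt_exp_iff.2 hy]

theorem tendsto_gaussCurvature :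
    Tendsto (gaussCurvature dumbbellForm) (𝓝[dumbbellDomain] 0) atTop := by
  have hnum : Tendsto (fun p : Fin 2 → ℝ => 2 * Real.exp (p 0 + p 1) - 1)
      (𝓝[dumbbellDomain] 0) (𝓝 1) := by
    refine Tendsto.mono_left (Continuous.tendsto' (by fun_prop) _ _ ?_) nhdsWithin_le_nhds
    norm_num
  have hden : Tendsto (fun p : Fin 2 → ℝ =>
      4 * Real.exp (p 0 + p 1) - 3 * Real.exp (p 0) - 3 * Real.exp (p 1) + 2)
      (𝓝[dumbbellDomain] 0) (𝓝[>] 0) := by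
    refine tendsto_nhdsWithin_iff.2 ⟨?_, eventually_mem_nhdsWithin.mono fun p hp =>
      denom_pos hp.1 hp.2.1⟩
    refine Tendsto.mono_left (Continuous.tendsto' (by fun_prop) _ _ ?_) nhdsWithin_le_nhds
    norm_num
  refine (hnum.pos_mul_atTop one_pos hden.inv_tendsto_nhdsGT_zero).congr' ?_
  filter_upwards [self_mem_nhdsWithin] with p hp
  exact (gaussCurvature_form hp.1 hp.2.1).symm

theorem neBot_nhdsWithin_domain : (𝓝[dumbbellDomain] (0 : Fin 2 → ℝ)).NeBot := by
  have hdiag : Tendsto (fun t : ℝ => (fun _ => t : Fin 2 → ℝ)) (𝓝[>] 0)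
      (𝓝[dumbbellDomain] 0) := by
    refine tendsto_nhdsWithin_iff.2 ⟨?_, ?_⟩
    · exact (Continuous.tendsto' (by fun_prop) _ _ rfl).mono_left nhdsWithin_le_nhds
    · have hcont : Continuous fun t : ℝ => (Real.exp t - 1) * (Real.exp t - 1) := by fun_prop
      have hlt : ∀ᶠ t in 𝓝 (0 : ℝ), (Real.exp t - 1) * (Real.exp t - 1) < 4 :=
        hcont.continuousAt.eventually_lt continuousAt_const (by norm_num)
      filter_upwards [self_mem_nhdsWithin, nhdsWithin_le_nhds hlt] with t ht ht4
      exact ⟨ht, ht, ht4⟩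
  exact hdiag.neBot

theorem not_bddAbove_gaussCurvature :
    ¬ BddAbove (gaussCurvature dumbbellForm '' dumbbellDomain) := by
  rintro ⟨C, hC⟩
  have := neBot_nhdsWithin_domain
  obtain ⟨p, hp, hpU⟩ := ((tendsto_gaussCurvature.eventually_gt_atTop C).and
    self_mem_nhdsWithin).exists
  exact absurd (hC (Set.mem_image_of_mem _ hpU)) (not_le.2 hp)

end Curvature

/-! ### Incompleteness -/

section Incompleteness

variable {l : dumbbell.EdgeFun} {γ : ℝ → dumbbell.EdgeFun} {r s t : ℝ}

/-- The mass of the bridge as a function on the surface. It is Lipschitz for the pressure metric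
and has no zero on the surface, so a curve along which it tends to zero leaves the surface. -/
def mass (l : dumbbell.EdgeFun) : ℝ := bridgeMass (l (0 : Fin 3)) (l (1 : Fin 3))

theorem bridgeMass_sq_mul_le_one {x y : ℝ} (hx : 0 < x) (hy : 0 < y) :
    bridgeMass x y ^ 2 * (metricCoeff x y + metricCoeff y x) ≤ 1 := by
  have hs := turns_pos hx
  have ht := turns_pos hy
  rw [metricCoeff, metricCoeff, bridgeMass_comm y, bridgeMass]
  generalize turns x = s at *
  generalize turns y = t at *
  have h : (1 / (4 + s + t)) ^ 2 * (1 / (4 + s + t) * (s * (1 + s)) +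
      1 / (4 + s + t) * (t * (1 + t))) = (s * (1 + s) + t * (1 + t)) / (4 + s + t) ^ 3 := by
    field_simp
  rw [h, div_le_one (by positivity)]
  nlinarith [mul_pos hs ht, mul_pos (mul_pos hs ht) hs, mul_pos (mul_pos hs ht) ht,
    pow_pos hs 3, pow_pos ht 3]

theorem abs_bridgeMass_mul_le (hl : OnSurface l) (a b : ℝ) :
    |bridgeMass (l (0 : Fin 3)) (l (1 : Fin 3)) * (metricCoeff (l (0 : Fin 3)) (l (1 : Fin 3)) * a +
      metricCoeff (l (1 : Fin 3)) (l (0 : Fin 3)) * b)| ≤ √(pressureSq l (tangentVec l a b)) := by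
  refine Real.abs_le_sqrt ?_
  have hle := bridgeMass_sq_mul_le_one hl.pos_left hl.pos_right
  have hE := metricCoeff_pos hl.pos_left hl.pos_right
  have hG := metricCoeff_pos hl.pos_right hl.pos_left
  rw [pressureSq_tangentVec hl]
  generalize metricCoeff (l (0 : Fin 3)) (l (1 : Fin 3)) = E at *
  generalize metricCoeff (l (1 : Fin 3)) (l (0 : Fin 3)) = G at *
  generalize bridgeMass (l (0 : Fin 3)) (l (1 : Fin 3)) = k at *
  have cauchy_schwarz : (E * a + G * b) ^ 2 ≤ (E + G) * (E * a ^ 2 + G * b ^ 2) := by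
    linarith [show (E + G) * (E * a ^ 2 + G * b ^ 2) - (E * a + G * b) ^ 2 =
      E * G * (a - b) ^ 2 by ring, show 0 ≤ E * G * (a - b) ^ 2 by positivity]
  calc (k * (E * a + G * b)) ^ 2
    _ = k ^ 2 * (E * a + G * b) ^ 2 := mul_pow ..
    _ ≤ k ^ 2 * ((E + G) * (E * a ^ 2 + G * b ^ 2)) := by gcongr
    _ = k ^ 2 * (E + G) * (E * a ^ 2 + G * b ^ 2) := (mul_assoc ..).symm
    _ ≤ E * a ^ 2 + G * b ^ 2 := mul_le_of_le_one_left (by positivity) hle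

theorem eq_tangentVec {S : Set ℝ} (hγ : ∀ r ∈ S, OnSurface (γ r)) (ht : t ∈ S)
    (hS : UniqueDiffWithinAt ℝ S t) {v : dumbbell.EdgeFun} (hv : HasDerivWithinAt γ v S t) :
    v = tangentVec (γ t) (v (0 : Fin 3)) (v (1 : Fin 3)) := by
  have hcoord := hasDerivWithinAt_pi.1 hv
  have hloops : HasDerivWithinAt (fun r => ![γ r (0 : Fin 3), γ r (1 : Fin 3)])
      ![v (0 : Fin 3), v (1 : Fin 3)] S t :=
    hasDerivWithinAt_pi.2 (Fin.forall_fin_two.2 ⟨hcoord (0 : Fin 3), hcoord (1 : Fin 3)⟩)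
  have hchart := hasDerivWithinAt_chart hloops (hγ t ht).pos_left (hγ t ht).pos_right
  rw [← (hγ t ht).eq_chart] at hchart
  exact hS.eq_deriv _ hv (hchart.congr_of_mem (fun r hr => (hγ r hr).eq_chart) ht)

theorem contDiffOn_mass (hγ : ContDiffOn ℝ 1 γ (Set.Icc 0 1))
    (hmem : ∀ t ∈ Set.Icc (0 : ℝ) 1, OnSurface (γ t)) :
    ContDiffOn ℝ 1 (fun t => mass (γ t)) (Set.Icc 0 1) := fun t ht => by
  have hcoord := contDiffWithinAt_pi.1 (hγ t ht)
  have hloops : ContDiffWithinAt ℝ 1 (fun t => ![γ t (0 : Fin 3), γ t (1 : Fin 3)])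
      (Set.Icc 0 1) t :=
    contDiffWithinAt_pi.2 (Fin.forall_fin_two.2 ⟨hcoord (0 : Fin 3), hcoord (1 : Fin 3)⟩)
  exact ContDiffAt.comp_contDiffWithinAt (g := fun q : Fin 2 → ℝ => bridgeMass (q 0) (q 1)) t
    (contDiffAt_bridgeMass (hmem t ht).pos_left (hmem t ht).pos_right) hloops

theorem enorm_mass_sub_le_pressureLength (hγ : ContDiffOn ℝ 1 γ (Set.Icc 0 1))
    (hmem : ∀ t ∈ Set.Icc (0 : ℝ) 1, OnSurface (γ t)) :
    ‖mass (γ 1) - mass (γ 0)‖ₑ ≤ pressureLength γ := by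
  refine (enorm_sub_le_lintegral_derivWithin_Icc_of_contDiffOn_Icc (contDiffOn_mass hγ hmem)
    zero_le_one).trans (setLIntegral_mono' measurableSet_Icc fun t ht => ?_)
  have hunique := uniqueDiffOn_Icc (zero_lt_one' ℝ) t ht
  have hv := (hγ.differentiableOn one_ne_zero t ht).hasDerivWithinAt
  have hmass := hasDerivWithinAt_bridgeMass (hasDerivWithinAt_pi.1 hv (0 : Fin 3))
    (hasDerivWithinAt_pi.1 hv (1 : Fin 3)) (hmem t ht).pos_left (hmem t ht).pos_right
  rw [eq_tangentVec hmem ht hunique hv, Real.enorm_eq_ofReal_abs]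
  change ENNReal.ofReal |derivWithin (fun r => bridgeMass (γ r (0 : Fin 3)) (γ r (1 : Fin 3)))
    (Set.Icc 0 1) t| ≤ _
  rw [hmass.derivWithin hunique]
  exact ENNReal.ofReal_le_ofReal (abs_bridgeMass_mul_le (hmem t ht) _ _)

theorem enorm_mass_sub_le_pressureDist (l₁ l₂ : dumbbell.EdgeFun) :
    ‖mass l₂ - mass l₁‖ₑ ≤ pressureDist l₁ l₂ := by
  refine le_iInf₂ fun γ hγ => ?_
  obtain ⟨hsmooth, hmem, rfl, rfl⟩ := hγ
  exact enorm_mass_sub_le_pressureLength hsmooth fun t ht => (mem_moduliOne_iff.1 (hmem t ht)).1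

/-- A curve of finite length that leaves the surface at `r = 0`: the loop on the left shrinks to a
point while the loop on the right keeps the length `log 2`. -/
def escape (r : ℝ) : dumbbell.EdgeFun := dumbbellChart ![Real.log (1 + r ^ 2), Real.log 2]

theorem log_one_add_sq_pos (hr : 0 < r) : 0 < Real.log (1 + r ^ 2) :=
  Real.log_pos (lt_add_of_pos_right 1 (pow_pos hr 2))

theorem turns_log_one_add_sq (r : ℝ) : turns (Real.log (1 + r ^ 2)) = 1 / r ^ 2 := by
  rw [turns, Real.exp_log (by positivity), add_sub_cancel_left]

theorem turns_log_two : turns (Real.log 2) = 1 := by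
  rw [turns, Real.exp_log two_pos]
  norm_num

theorem onSurface_escape (hr : 0 < r) : OnSurface (escape r) :=
  onSurface_chart (log_one_add_sq_pos hr) (Real.log_pos one_lt_two)

theorem escape_mem (hr : r ∈ Set.Ioc (0 : ℝ) 1) : escape r ∈ dumbbell.moduliOne := by
  refine (chart_mem_moduliOne_iff (log_one_add_sq_pos hr.1) (Real.log_pos one_lt_two)).2 ?_
  simp only [Matrix.cons_val_zero, Matrix.cons_val_one]
  rw [Real.exp_log (by positivity), Real.exp_log two_pos]
  nlinarith [hr.1, hr.2]

theorem mass_escape (hr : 0 < r) : mass (escape r) = r ^ 2 / (5 * r ^ 2 + 1) := by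
  change bridgeMass (Real.log (1 + r ^ 2)) (Real.log 2) = _
  rw [bridgeMass, turns_log_one_add_sq, turns_log_two]
  field_simp
  ring

theorem contDiffAt_chart {p : Fin 2 → ℝ} (hx : 0 < p 0) (hy : 0 < p 1) {n : WithTop ℕ∞} :
    ContDiffAt ℝ n dumbbellChart p := by
  have hpos := mul_pos (exp_sub_one_pos hx) (exp_sub_one_pos hy)
  refine contDiffAt_pi.2 (forall_edge ?_ ?_ ?_)
  · exact (contDiff_apply ℝ ℝ (0 : Fin 2)).contDiffAt
  · exact (contDiff_apply ℝ ℝ (1 : Fin 2)).contDiffAt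
  · exact contDiffAt_const.sub (contDiffAt_const.mul
      (ContDiffAt.log (ContDiff.contDiffAt (by fun_prop)) hpos.ne'))

theorem contDiffOn_escape : ContDiffOn ℝ 1 escape (Set.Ioi 0) := fun r hr => by
  have hloops : ContDiffAt ℝ 1 (fun r : ℝ => ![Real.log (1 + r ^ 2), Real.log 2]) r :=
    contDiffAt_pi.2 (Fin.forall_fin_two.2
      ⟨ContDiffAt.log (ContDiff.contDiffAt (by fun_prop)) (by positivity), contDiffAt_const⟩)
  exact ((contDiffAt_chart (log_one_add_sq_pos hr) (Real.log_pos one_lt_two)).comp r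
    hloops).contDiffWithinAt

theorem hasDerivWithinAt_escape {ρ : ℝ → ℝ} {ρ' : ℝ} {S : Set ℝ}
    (hρ : HasDerivWithinAt ρ ρ' S t) (h0 : 0 < ρ t) :
    HasDerivWithinAt (fun r => escape (ρ r))
      (tangentVec (escape (ρ t)) (2 * ρ t * ρ' / (1 + ρ t ^ 2)) 0) S t := by
  have hlog : HasDerivWithinAt (fun r => Real.log (1 + ρ r ^ 2))
      (2 * ρ t * ρ' / (1 + ρ t ^ 2)) S t := by
    have hne : 1 + ρ t ^ 2 ≠ 0 := by positivity
    simpa using ((hρ.pow 2).const_add 1).log hne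
  have hloops : HasDerivWithinAt (fun r => ![Real.log (1 + ρ r ^ 2), Real.log 2])
      ![2 * ρ t * ρ' / (1 + ρ t ^ 2), 0] S t :=
    hasDerivWithinAt_pi.2 (Fin.forall_fin_two.2 ⟨hlog, hasDerivWithinAt_const ..⟩)
  exact hasDerivWithinAt_chart hloops (log_one_add_sq_pos h0) (Real.log_pos one_lt_two)

theorem pressureSq_escape_le (hr : 0 < r) (d : ℝ) :
    pressureSq (escape r) (tangentVec (escape r) (2 * r * d / (1 + r ^ 2)) 0) ≤ (2 * d) ^ 2 := by
  rw [pressureSq_tangentVec (onSurface_escape hr)]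
  change metricCoeff (Real.log (1 + r ^ 2)) (Real.log 2) * _ + _ * 0 ^ 2 ≤ _
  have hspeed : metricCoeff (Real.log (1 + r ^ 2)) (Real.log 2) * (2 * r * d / (1 + r ^ 2)) ^ 2 =
      (2 * d) ^ 2 / ((5 * r ^ 2 + 1) * (1 + r ^ 2)) := by
    rw [metricCoeff, bridgeMass, turns_log_one_add_sq, turns_log_two]
    field_simp
    ring
  rw [hspeed, zero_pow two_ne_zero, mul_zero, add_zero]
  exact div_le_self (sq_nonneg _) (by nlinarith [sq_nonneg r, sq_nonneg (r ^ 2)])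

theorem pressureDist_escape_le (hr : r ∈ Set.Ioc (0 : ℝ) 1) (hs : s ∈ Set.Ioc (0 : ℝ) 1) :
    pressureDist (escape r) (escape s) ≤ 2 * edist r s := by
  let ρ : ℝ → ℝ := AffineMap.lineMap r s
  have hρ (t : ℝ) (ht : t ∈ Set.Icc (0 : ℝ) 1) : ρ t ∈ Set.Ioc (0 : ℝ) 1 :=
    (convex_Ioc 0 1).lineMap_mem hr hs ht
  have hsmooth : ContDiffOn ℝ 1 (fun t => escape (ρ t)) (Set.Icc 0 1) :=
    contDiffOn_escape.comp (AffineMap.contDiff_lineMap r s).contDiffOn fun t ht => (hρ t ht).1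
  have hspeed (t : ℝ) (ht : t ∈ Set.Icc (0 : ℝ) 1) :
      ENNReal.ofReal √(pressureSq (escape (ρ t))
        (derivWithin (fun t => escape (ρ t)) (Set.Icc 0 1) t)) ≤ 2 * edist r s := by
    rw [(hasDerivWithinAt_escape AffineMap.hasDerivWithinAt_lineMap (hρ t ht).1).derivWithin
      (uniqueDiffOn_Icc zero_lt_one t ht), edist_comm, edist_eq_enorm_sub,
      Real.enorm_eq_ofReal_abs, ← ENNReal.ofReal_ofNat, ← ENNReal.ofReal_mul zero_le_two]
    refine ENNReal.ofReal_le_ofReal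
      ((Real.sqrt_le_sqrt (pressureSq_escape_le (hρ t ht).1 _)).trans ?_)
    rw [Real.sqrt_sq_eq_abs, abs_mul, abs_two]
  calc pressureDist (escape r) (escape s)
    _ ≤ pressureLength fun t => escape (ρ t) :=
      iInf₂_le _ ⟨hsmooth, fun t ht => escape_mem (hρ t ht), by simp [ρ], by simp [ρ]⟩
    _ ≤ ∫⁻ _ in Set.Icc (0 : ℝ) 1, 2 * edist r s := setLIntegral_mono' measurableSet_Icc hspeed
    _ = 2 * edist r s := by simp

theorem one_div_add_one_mem_Ioc (n : ℕ) : (1 : ℝ) / (n + 1) ∈ Set.Ioc (0 : ℝ) 1 :=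
  ⟨Nat.one_div_pos_of_nat, (div_le_one (by positivity)).2 (by linarith [n.cast_nonneg (α := ℝ)])⟩

theorem tendsto_mass_escape :
    Tendsto (fun n : ℕ => mass (escape (1 / (n + 1)))) atTop (𝓝 0) := by
  have h0 := tendsto_one_div_add_atTop_nhds_zero_nat (𝕜 := ℝ)
  have h := (h0.pow 2).div (((h0.pow 2).const_mul 5).add_const 1) (by norm_num)
  simpa using h.congr fun n => (mass_escape (one_div_add_one_mem_Ioc n).1).symm

theorem not_pressureComplete : ¬ dumbbell.PressureComplete := by
  intro hcomplete
  obtain ⟨l, hl, hlim⟩ := hcomplete (fun n => escape (1 / (n + 1)))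
    (fun n => escape_mem (one_div_add_one_mem_Ioc n)) (fun ε hε => by
      have hcauchy := (tendsto_one_div_add_atTop_nhds_zero_nat (𝕜 := ℝ)).cauchySeq
      obtain ⟨N, hN⟩ := EMetric.cauchySeq_iff.1 hcauchy (ε / 2) (ENNReal.half_pos hε.ne')
      exact ⟨N, fun m hm n hn => (pressureDist_escape_le (one_div_add_one_mem_Ioc m)
        (one_div_add_one_mem_Ioc n)).trans_lt (ENNReal.mul_lt_of_lt_div' (hN m hm n hn))⟩)
  have hdist : Tendsto (fun n : ℕ => ‖mass l - mass (escape (1 / (n + 1)))‖ₑ) atTop (𝓝 0) :=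
    tendsto_of_tendsto_of_tendsto_of_le_of_le tendsto_const_nhds hlim (fun _ => zero_le)
      fun n => enorm_mass_sub_le_pressureDist _ _
  have hmass := tendsto_nhds_unique hdist (tendsto_const_nhds.sub tendsto_mass_escape).enorm
  have hs := (mem_moduliOne_iff.1 hl).1
  rw [sub_zero] at hmass
  exact (bridgeMass_pos hs.pos_left hs.pos_right).ne' (enorm_eq_zero.1 hmass.symm)

end Incompleteness

end Dumbbell

end

theorem proposition4p8 :
    -- the entropy-one moduli space is the surface parametrized by the coordinates (x, y)
    dumbbell.moduliOne = dumbbellChart '' dumbbellDomain ∧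
    -- on it the equilibrium state exists and is unique, and the variances converge
    (∀ l ∈ dumbbell.moduliOne,
      (∃! m, FinGraph.IsEquilibriumState (fun x => - FinGraph.onPath l x) m) ∧
      ∀ φ : dumbbell.EdgeFun,
        Tendsto (FinGraph.varianceSeq (FinGraph.onPath φ) (FinGraph.eqState l)) atTop
          (𝓝 (FinGraph.pressureSq l φ))) ∧
    -- the pressure metric is a smooth Riemannian metric, diagonal in these coordinates
    (∀ i j, ContDiffOn ℝ (⊤ : ℕ∞) (fun p => dumbbellForm p i j) dumbbellDomain) ∧
    (∀ p ∈ dumbbellDomain, dumbbellForm p 0 1 = 0 ∧ dumbbellForm p 1 0 = 0 ∧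
      0 < dumbbellForm p 0 0 ∧ 0 < dumbbellForm p 1 1) ∧
    -- its Gaussian curvature
    (∀ p ∈ dumbbellDomain, gaussCurvature dumbbellForm p =
      (2 * Real.exp (p 0 + p 1) - 1) /
        (4 * Real.exp (p 0 + p 1) - 3 * Real.exp (p 0) - 3 * Real.exp (p 1) + 2)) ∧
    -- is bounded below by a positive constant,
    (∃ c : ℝ, 0 < c ∧ ∀ p ∈ dumbbellDomain, c ≤ gaussCurvature dumbbellForm p) ∧
    -- is unbounded above, and tends to infinity at the origin
    ¬ BddAbove (gaussCurvature dumbbellForm '' dumbbellDomain) ∧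
    Tendsto (gaussCurvature dumbbellForm) (𝓝[dumbbellDomain] 0) atTop ∧
    -- and the metric is incomplete
    ¬ dumbbell.PressureComplete := by
  refine ⟨Dumbbell.moduliOne_eq, fun l hl => ?_, Dumbbell.contDiffOn_form, fun p hp => ?_,
    fun p hp => Dumbbell.gaussCurvature_form hp.1 hp.2.1,
    ⟨1 / 2, one_half_pos, fun p hp => Dumbbell.half_le_gaussCurvature hp.1 hp.2.1⟩,
    Dumbbell.not_bddAbove_gaussCurvature, Dumbbell.tendsto_gaussCurvature,
    Dumbbell.not_pressureComplete⟩
  · have hs := (Dumbbell.mem_moduliOne_iff.1 hl).1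
    refine ⟨(Dumbbell.perron hs).existsUnique_isEquilibriumState Dumbbell.irreducible, fun φ => ?_⟩
    rw [Dumbbell.pressureSq_eq hs]
    exact Dumbbell.tendsto_varianceSeq hs φ
  · simp only [Dumbbell.dumbbellForm_apply hp.1 hp.2.1]
    exact ⟨rfl, rfl, Dumbbell.metricCoeff_pos hp.1 hp.2.1, Dumbbell.metricCoeff_pos hp.2.1 hp.1⟩
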